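/- **Conventions.** Let $X$ be a proper CAT(0) space. * Geodesic rays $[0,\infty)\to X$ and bi-infinite geodesics $\mathbb R\to X$ are isometric embeddings. Two rays are equivalent if their images have finite Hausdorff distance. The visual boundary $\partial X$ is the set of equivalence classes. For a basepoint $x_0\in X$ it carries the topology obtained by identifying each class with the ray from $x_0$ that represents it, rays being given the topology of uniform convergence on compact sets. * A geodesic $\alpha$ is *$D$-contracting* ($D\ge 0$) if for every metric ball $B$ disjoint from $\alpha$ the nearest point projection of $B$ to $\alpha$ has diameter at most $D$. * $\partial_*^DX\subset\partial X$ is the subspace of the points represented by a $D$-contracting ray based at $x_0$. The Morse boundary of $X$ (with basepoint $x_0$) is $\partial_*X=\bigcup_{D\ge0}\partial_*^DX$ with the direct limit topology: a set is open if and only if its intersection with each $\partial_*^DX$ is open in $\partial_*^DX$. * For $a,c\in\partial_*X$, $(a,c)$ denotes the set of bi-infinite geodesics from $a$ to $c$. Let $\partial_*X^{(n,D)}$ be the set of $n$-tuples $(a_1,\dots,a_n)$ of distinct points of $\partial_*X$ such that for all $i\ne j$ every geodesic in $(a_i,a_j)$ is $D$-contracting. * For a bi-infinite geodesic $\alpha$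 and $b\in\partial_*X$, let $P_\alpha(b)\subset\alpha$ be the set of all limit points of sequences $\pi_\alpha(\beta(t_i))$, where $\beta$ is any ray representing $b$, $t_i\to\infty$, and $\pi_\alpha$ is the nearest point projection to $\alpha$. The projection $\pi_\alpha(b)$ is the barycenter of $P_\alpha(b)$, i.e. the center of the smallest closed ball containing it. * For distinct $a,b,c,d\in\partial_*X$ the absolute value of the cross-ratio is $|[a,b,c,d]|=\sup_{\alpha\in(a,c)}d(\pi_\alpha(b),\pi_\alpha(d))$, a real number. Let $Y$ be a second proper CAT(0) space. A map $f:\partial_*X\to\partial_*Y$ is *2-stable* if for every $D\ge0$ there is $D'\ge0$ such that $f$ maps $\partial_*X^{(2,D)}$ into $\partial_*Y^{(2,D')}$. For a function $\psi:[0,\infty)\to[0,\infty)$, say that $f$ is *controlled by $\psi$ on $D$-contracting 4-tuples* if $$|[f(a),f(b),f(c),f(d)]|\le\psi\bigl(|[a,b,c,d]|\bigr)\qquad\text{for all }(a,b,c,d)\in\partial_*X^{(4,D)}.$$ A homeomorphism $f$ is *quasi-mobius* if for every $D\ge 0$ each of $f$ and $f^{-1}$ is controlled on $D$-contracting 4-tuples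 by some continuous function $\psi_D:[0,\infty)\to[0,\infty)$. A map $h:X\to Y$ is a *$(\lambda,\epsilon)$-quasi-isometry* ($\lambda\ge1$, $\epsilon\ge0$) if $\frac1\lambda d(x,x')-\epsilon\le d(h(x),h(x'))\le\lambda d(x,x')+\epsilon$ for all $x,x'\in X$, and every point of $Y$ is within some fixed distance of $h(X)$. A map $g:\partial_*X\to\partial_*Y$ is *induced by $h$* if for every $\xi\in\partial_*X$ and every ray $\alpha$ representing $\xi$, the set $h(\alpha)$ has finite Hausdorff distance from some ray representing $g(\xi)$. **Theorem.** Let $h:X\to Y$ be a $(\lambda,\epsilon)$-quasi-isometry between proper CAT(0) spaces, and let $x_0\in X$, $y_0\in Y$ be any basepoints. Then there is exactly one map $\partial_*h:\partial_*X\to\partial_*Y$ induced by $h$, and it is a 2-stable, quasi-mobius homeomorphism. Moreover, the functions $\psi_D$ in the definition of quasi-mobius can all be taken linear with multiplicative constant $\lambda$: for every $D\ge0$ there is $C\ge0$ such that both $\partial_*h$ and $(\partial_*h)^{-1}$ are controlled on $D$-contracting 4-tuples by $\psi_D(t)=\lambda t+C$. -/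

import Mathlib

open Set Filter Topology
open scoped NNReal ENNReal

universe u v

/-- A CAT(0) space: a geodesic metric space in which every geodesic triangle is at least as thin
as its comparison triangle in the Euclidean plane.  In a geodesic space the points `x` with
`dist p x + dist x q = dist p q` are exactly the points on geodesics from `p` to `q`; hence `x` and
`y` below are arbitrary points on two sides of an arbitrary geodesic triangle with vertices
`p, q, r`, and `x', y'` are their comparison points. -/
class CAT0Space (X : Type u) [MetricSpace X] : Prop where
  exists_geodesic : ∀ x y : X, ∃ γ : ℝ → X, γ 0 = x ∧ γ (dist x y) = y ∧
    ∀ s ∈ Icc 0 (dist x y), ∀ t ∈ Icc 0 (dist x y), dist (γ s) (γ t) = |s - t|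
  comparison : ∀ (p q r x y : X) (p' q' r' x' y' : EuclideanSpace ℝ (Fin 2)),
    dist p' q' = dist p q → dist p' r' = dist p r → dist q' r' = dist q r →
    dist p x + dist x q = dist p q → dist p y + dist y r = dist p r →
    dist p' x' = dist p x → dist x' q' = dist x q →
    dist p' y' = dist p y → dist y' r' = dist y r →
    dist x y ≤ dist x' y'

/-- A `(lam, eps)`-quasi-isometry (not assumed continuous). -/
structure IsQuasiIsometry {X : Type u} {Y : Type v} [MetricSpace X] [MetricSpace Y]
    (lam eps : ℝ≥0) (h : X → Y) : Prop where
  one_le : 1 ≤ lam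
  lower : ∀ x x' : X, dist x x' / lam - eps ≤ dist (h x) (h x')
  upper : ∀ x x' : X, dist (h x) (h x') ≤ lam * dist x x' + eps
  coarsely_onto : ∃ C : ℝ, ∀ y : Y, ∃ x : X, dist (h x) y ≤ C

section Boundary

variable {X : Type u} [MetricSpace X]

/-- `p` is a nearest point projection of `x` to `S`. -/
def IsNearestPoint (S : Set X) (x p : X) : Prop :=
  p ∈ S ∧ ∀ q ∈ S, dist x p ≤ dist x q

/-- `S` is `D`-contracting: the projection to `S` of every metric ball disjoint from `S` has
diameter at most `D`. -/
def IsContracting (D : ℝ≥0) (S : Set X) : Prop :=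
  ∀ (x : X) (r : ℝ), Disjoint (Metric.ball x r) S →
    ∀ y ∈ Metric.ball x r, ∀ z ∈ Metric.ball x r, ∀ p q : X,
      IsNearestPoint S y p → IsNearestPoint S z q → dist p q ≤ D

variable (X) in
/-- Geodesic rays `[0, ∞) → X`, with the topology of uniform convergence on compact sets. -/
abbrev GeodesicRay : Type u := {α : C(ℝ≥0, X) // Isometry α}

variable (X) in
/-- Bi-infinite geodesics. -/
abbrev GeodesicLine : Type u := {γ : ℝ → X // Isometry γ}

variable (X) in
/-- Two rays are equivalent if they have finite Hausdorff distance. -/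
def asymptoticSetoid : Setoid (GeodesicRay X) where
  r α β := Metric.hausdorffEDist (range α.1) (range β.1) ≠ ⊤
  iseqv :=
    { refl := fun α => by simp
      symm := fun {α β} hab => by rwa [Metric.hausdorffEDist_comm]
      trans := fun {α β γ} hab hbc =>
        ne_top_of_le_ne_top (ENNReal.add_ne_top.2 ⟨hab, hbc⟩) Metric.hausdorffEDist_triangle }

variable (X) in
/-- The visual boundary (as a set). -/
def VisualBoundary : Type u := Quotient (asymptoticSetoid X)

/-- The point at infinity of a ray. -/
def GeodesicRay.endpoint (α : GeodesicRay X) : VisualBoundary X :=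
  Quotient.mk (asymptoticSetoid X) α

/-- The topology of the visual boundary with basepoint `x₀`: a boundary point is identified with
the ray from `x₀` that represents it, and two rays are near each other if they stay close for a
long time. -/
abbrev visualTopology (x₀ : X) : TopologicalSpace (VisualBoundary X) :=
  TopologicalSpace.coinduced
    (fun α : {α : GeodesicRay X // α.1 0 = x₀} => GeodesicRay.endpoint α.1) inferInstance

/-- The boundary points that are represented by a `D`-contracting ray based at `x₀`. -/
def morseStratum (x₀ : X) (D : ℝ≥0) : Set (VisualBoundary X) :=
  {ξ | ∃ α : GeodesicRay X, α.1 0 = x₀ ∧ α.endpoint = ξ ∧ IsContracting D (range α.1)}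

/-- The Morse boundary with basepoint `x₀`: the union of the strata. -/
@[ext]
structure MorseBoundary (x₀ : X) : Type u where
  point : VisualBoundary X
  exists_mem_stratum : ∃ D : ℝ≥0, point ∈ morseStratum x₀ D

/-- The inclusion of a stratum in the Morse boundary. -/
def morseInclusion (x₀ : X) (D : ℝ≥0) (ξ : morseStratum x₀ D) : MorseBoundary x₀ :=
  ⟨ξ.1, D, ξ.2⟩

/-- The direct limit topology: a set is open if and only if its trace on every stratum is open in
the topology that the stratum inherits from the visual boundary. -/
instance morseTopology (x₀ : X) : TopologicalSpace (MorseBoundary x₀) :=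
  ⨆ D : ℝ≥0, TopologicalSpace.coinduced (morseInclusion x₀ D)
    (TopologicalSpace.induced Subtype.val (visualTopology x₀))

/-- The ray `t ↦ γ t` of a bi-infinite geodesic. -/
def GeodesicLine.forwardRay (γ : GeodesicLine X) : GeodesicRay X :=
  ⟨⟨fun t : ℝ≥0 => γ.1 (t : ℝ), γ.2.continuous.comp NNReal.continuous_coe⟩,
    γ.2.comp NNReal.isometry_coe⟩

/-- The ray `t ↦ γ (-t)` of a bi-infinite geodesic. -/
def GeodesicLine.backwardRay (γ : GeodesicLine X) : GeodesicRay X :=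
  ⟨⟨fun t : ℝ≥0 => γ.1 (-(t : ℝ)), γ.2.continuous.comp NNReal.continuous_coe.neg⟩,
    γ.2.comp ((IsometryEquiv.neg ℝ).isometry.comp NNReal.isometry_coe)⟩

/-- The bi-infinite geodesic `γ` goes from `a` to `c`. -/
def GeodesicLine.Joins (γ : GeodesicLine X) (a c : VisualBoundary X) : Prop :=
  γ.backwardRay.endpoint = a ∧ γ.forwardRay.endpoint = c

/-- The `n`-tuples of distinct points of the Morse boundary such that all bi-infinite geodesics
between any two of them are `D`-contracting. -/
def contractingTuples (x₀ : X) (n : ℕ) (D : ℝ≥0) : Set (Fin n → MorseBoundary x₀) :=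
  {a | Function.Injective a ∧ ∀ i j, i ≠ j → ∀ γ : GeodesicLine X,
    γ.Joins (a i).point (a j).point → IsContracting D (range γ.1)}

/-- The limit points of the sequences of projections of `β (t i)` to `γ`, where `t i → ∞` and
`β` is any ray representing `b`. -/
def projectionLimits (γ : GeodesicLine X) (b : VisualBoundary X) : Set X :=
  {p | ∃ (β : GeodesicRay X) (t : ℕ → ℝ≥0) (q : ℕ → X), β.endpoint = b ∧
    Tendsto t atTop atTop ∧ (∀ i, IsNearestPoint (range γ.1) (β.1 (t i)) (q i)) ∧
    Tendsto q atTop (𝓝 p)}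

/-- `c` is the barycenter of `P`: the center of a smallest closed ball that contains `P`.
(In a proper CAT(0) space a bounded nonempty set has exactly one.) -/
def IsBarycenter (P : Set X) (c : X) : Prop :=
  ∃ r : ℝ, P ⊆ Metric.closedBall c r ∧
    ∀ (c' : X) (r' : ℝ), P ⊆ Metric.closedBall c' r' → r ≤ r'

/-- `p` is the projection of the boundary point `b` to the bi-infinite geodesic `γ`. -/
def IsBoundaryProjection (γ : GeodesicLine X) (b : VisualBoundary X) (p : X) : Prop :=
  IsBarycenter (projectionLimits γ b) p

/-- `r` is the absolute value of the cross-ratio `[a, b, c, d]`, that is, the supremum over all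
bi-infinite geodesics from `a` to `c` of the distance between the projections of `b` and `d`.
The least upper bound is taken in `ℝ`, so the set is nonempty and bounded when this holds. -/
def HasAbsCrossRatio {x₀ : X} (a b c d : MorseBoundary x₀) (r : ℝ) : Prop :=
  IsLUB {s : ℝ | ∃ (γ : GeodesicLine X) (p q : X), γ.Joins a.point c.point ∧
    IsBoundaryProjection γ b.point p ∧ IsBoundaryProjection γ d.point q ∧ s = dist p q} r

end Boundary

section Maps

variable {X : Type u} {Y : Type v} [MetricSpace X] [MetricSpace Y] {x₀ : X} {y₀ : Y}

/-- `f` is the map of Morse boundaries induced by `h`: for every ray `α` representing `ξ`, the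
image of `α` under `h` has finite Hausdorff distance from a ray representing `f ξ`. -/
def IsInducedBoundaryMap (h : X → Y) (f : MorseBoundary x₀ → MorseBoundary y₀) : Prop :=
  ∀ (ξ : MorseBoundary x₀) (α : GeodesicRay X), α.endpoint = ξ.point →
    ∃ β : GeodesicRay Y, β.endpoint = (f ξ).point ∧
      Metric.hausdorffEDist (h '' range α.1) (range β.1) ≠ ⊤

/-- Two-stable maps. -/
def IsTwoStable (f : MorseBoundary x₀ → MorseBoundary y₀) : Prop :=
  ∀ D : ℝ≥0, ∃ D' : ℝ≥0, ∀ a ∈ contractingTuples x₀ 2 D, f ∘ a ∈ contractingTuples y₀ 2 D'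

/-- `|[f a, f b, f c, f d]| ≤ ψ |[a, b, c, d]|` on all 4-tuples that are `D`-contracting. -/
def CrossRatioControl (D : ℝ≥0) (ψ : ℝ≥0 → ℝ≥0) (f : MorseBoundary x₀ → MorseBoundary y₀) :
    Prop :=
  ∀ a ∈ contractingTuples x₀ 4 D, ∃ r r' : ℝ≥0,
    HasAbsCrossRatio (a 0) (a 1) (a 2) (a 3) r ∧
    HasAbsCrossRatio (f (a 0)) (f (a 1)) (f (a 2)) (f (a 3)) r' ∧ r' ≤ ψ r

/-- Quasi-mobius homeomorphisms. -/
def IsQuasiMobius (f : MorseBoundary x₀ ≃ₜ MorseBoundary y₀) : Prop :=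
  ∀ D : ℝ≥0, (∃ ψ : ℝ≥0 → ℝ≥0, Continuous ψ ∧ CrossRatioControl D ψ f) ∧
    (∃ ψ : ℝ≥0 → ℝ≥0, Continuous ψ ∧ CrossRatioControl D ψ f.symm)

end Maps

/-!
Contracting rays and lines satisfy the Morse lemma: a quasi-geodesic with endpoints near a
contracting set stays near it, because a long excursion would have a projection that is short
compared with its length (`morse_segment`, `morse_line`).  In a CAT(0) space the converse holds,
even if only the two-segment paths `[p, z] ∪ [z, q]` are considered in which `z` is the point of a
geodesic `[x, q]` nearest to `p` (`slim_of_cornerMorse`, `isContracting_of_slim`).  The Morse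
property is transported by quasi-isometries, and so contraction is as well, with a constant that
depends on the contraction constant and the quasi-isometry only
(`IsQIPair.contracting_transfer`).

Let `k` be a quasi-inverse of `h`.  If `α` is a contracting ray from `x₀`, the geodesics from `y₀`
to `h (α n)` are mapped by `k` near `α`, and hence subconverge to a contracting ray near `h α`
(`IsQIPair.exists_ray`).  This defines the induced map (`IsQIPair.exists_induced`).  It sends
strata to strata, it is continuous on each of them by convexity of the distance
(`IsQIPair.continuous_induced`), and the map induced by `k` is its inverse
(`IsQIPair.leftInverse`).  Distinct points of the Morse boundary are joined by lines
(`exists_line_joins`), and contraction of lines is transported as for rays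
(`IsQIPair.line_near`), which gives 2-stability.

For the cross-ratio the point is that `h` coarsely commutes with the projections of boundary points
to lines.  (It need not coarsely commute with the projections of points of `X`: in the universal
cover of the complement of a disk in the plane, a logarithmic twist is a counterexample.)
The projection of `b` to a contracting line from `a` to `c` is close to all three sides of the
ideal triangle `a, b, c` (`nearTriangle_of_isBoundaryProjection`), a property that `h` preserves.
Any two points with this property are close to each other, by convexity of the distance
alone (`NearTriangle.dist_le`).  So the distance of the projections of `b` and `d` grows under `h`
at most by the factor `λ` and an additive constant (`IsQIPair.dist_projections_le`), and the same
applies to `k`, whose multiplicative constant is also `λ`.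
-/

namespace CAT0

/-! ### Consequences of the comparison axiom -/

theorem exists_comparison_triangle {a b c : ℝ} (ha : 0 ≤ a) (hb : 0 ≤ b) (hc : 0 ≤ c)
    (habc : a ≤ b + c) (hbac : b ≤ a + c) (hcab : c ≤ a + b) :
    ∃ p q r : EuclideanSpace ℝ (Fin 2), dist p q = a ∧ dist p r = b ∧ dist q r = c := by
  rcases eq_or_lt_of_le ha with h0 | h0
  · subst h0
    have hbc : b = c := by linarith
    subst hbc
    refine ⟨!₂[0, 0], !₂[0, 0], !₂[b, 0], ?_, ?_, ?_⟩ <;>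
      simp [EuclideanSpace.dist_eq, Fin.sum_univ_two, hb]
  · set w := (a ^ 2 + b ^ 2 - c ^ 2) / (2 * a) with hw
    have hwa : 2 * a * w = a ^ 2 + b ^ 2 - c ^ 2 := by rw [hw]; field_simp
    have hle : 0 ≤ b ^ 2 - w ^ 2 := by
      have h1 : 0 ≤ (2 * a * b) ^ 2 - (2 * a * w) ^ 2 := by
        rw [hwa]
        have : (2 * a * b) ^ 2 - (a ^ 2 + b ^ 2 - c ^ 2) ^ 2 =
          ((a + b + c) * (a + b - c)) * ((c + a - b) * (c - a + b)) := by ring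
        rw [this]
        apply mul_nonneg <;> apply mul_nonneg <;> linarith
      have h2 : (2 * a * b) ^ 2 - (2 * a * w) ^ 2 = (2 * a) ^ 2 * (b ^ 2 - w ^ 2) := by ring
      rw [h2] at h1
      exact nonneg_of_mul_nonneg_right h1 (by positivity)
    have hs := Real.sq_sqrt hle
    refine ⟨!₂[0, 0], !₂[a, 0], !₂[w, √(b ^ 2 - w ^ 2)], ?_, ?_, ?_⟩
    · simp [EuclideanSpace.dist_eq, Fin.sum_univ_two, ha]
    · simp only [EuclideanSpace.dist_eq, Fin.sum_univ_two, Real.dist_eq]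
      rw [Real.sqrt_eq_iff_mul_self_eq (by positivity) hb]
      simp only [sq_abs]; simp; nlinarith
    · simp only [EuclideanSpace.dist_eq, Fin.sum_univ_two, Real.dist_eq]
      rw [Real.sqrt_eq_iff_mul_self_eq (by positivity) hc]
      simp only [sq_abs]; simp; nlinarith

theorem norm_sq_lineMap {E : Type*} [NormedAddCommGroup E] [InnerProductSpace ℝ E] (x y : E)
    (t : ℝ) : ‖(1 - t) • x + t • y‖ ^ 2 =
      (1 - t) * ‖x‖ ^ 2 + t * ‖y‖ ^ 2 - t * (1 - t) * ‖x - y‖ ^ 2 := by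
  rw [norm_add_sq_real, norm_sub_sq_real, norm_smul, norm_smul, mul_pow, mul_pow,
    real_inner_smul_left, real_inner_smul_right, Real.norm_eq_abs, Real.norm_eq_abs, sq_abs, sq_abs]
  ring

variable {X : Type u} [MetricSpace X] [CAT0Space X]

/-- The form in which the comparison axiom is used: the distance from `p` to a point of a side
`[q, r]` is bounded by Stewart's formula. -/
theorem dist_sq_le {p q r m : X} {t : ℝ} (h0 : 0 ≤ t) (h1 : t ≤ 1)
    (hq : dist q m = t * dist q r) (hr : dist m r = (1 - t) * dist q r) :
    dist p m ^ 2 ≤ (1 - t) * dist p q ^ 2 + t * dist p r ^ 2 - t * (1 - t) * dist q r ^ 2 := by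
  obtain ⟨q', r', p', h₁, h₂, h₃⟩ := exists_comparison_triangle (a := dist q r) (b := dist q p)
    (c := dist r p) dist_nonneg dist_nonneg dist_nonneg
    (by have := dist_triangle q p r; rwa [dist_comm p r] at this) (dist_triangle q r p)
    (by have := dist_triangle r q p; rwa [dist_comm r q] at this)
  set m' : EuclideanSpace ℝ (Fin 2) := (1 - t) • q' + t • r' with hm'
  have e1 : q' - m' = t • (q' - r') := by rw [hm']; module
  have e2 : m' - r' = (1 - t) • (q' - r') := by rw [hm']; module
  have e3 : p' - m' = (1 - t) • (p' - q') + t • (p' - r') := by rw [hm']; module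
  have k := CAT0Space.comparison q r p m p q' r' p' m' p' h₁ h₂ h₃ (by rw [hq, hr]; ring)
    (by simp) (by rw [hq, ← h₁, dist_eq_norm, e1, norm_smul, dist_eq_norm, Real.norm_eq_abs,
      abs_of_nonneg h0]) (by rw [hr, ← h₁, dist_eq_norm, e2, norm_smul, dist_eq_norm,
      Real.norm_eq_abs, abs_of_nonneg (by linarith)]) h₂ (by simp)
  have e4 : dist p' m' ^ 2 = (1 - t) * dist p q ^ 2 + t * dist p r ^ 2
      - t * (1 - t) * dist q r ^ 2 := by
    rw [dist_eq_norm, e3, norm_sq_lineMap, ← dist_eq_norm, ← dist_eq_norm,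
      show p' - q' - (p' - r') = r' - q' by module, ← dist_eq_norm, dist_comm r' q', h₁,
      dist_comm p' q', h₂, dist_comm p' r', h₃, dist_comm q p, dist_comm r p]
  rw [← e4]
  rw [dist_comm m p, dist_comm m' p'] at k
  gcongr

theorem exists_point_between (x y : X) {s : ℝ} (h0 : 0 ≤ s) (h1 : s ≤ dist x y) :
    ∃ m, dist x m = s ∧ dist m y = dist x y - s := by
  obtain ⟨γ, g0, g1, g⟩ := CAT0Space.exists_geodesic x y
  refine ⟨γ s, ?_, ?_⟩
  · rw [← g0, g 0 ⟨le_rfl, dist_nonneg⟩ s ⟨h0, h1⟩, zero_sub, abs_neg, abs_of_nonneg h0]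
  · conv_lhs => rw [← g1]
    rw [g s ⟨h0, h1⟩ _ ⟨dist_nonneg, le_rfl⟩, abs_sub_comm, abs_of_nonneg (by linarith)]

theorem exists_ratio_between (x y : X) {t : ℝ} (h0 : 0 ≤ t) (h1 : t ≤ 1) :
    ∃ m, dist x m = t * dist x y ∧ dist m y = (1 - t) * dist x y := by
  obtain ⟨m, a, b⟩ := exists_point_between x y (s := t * dist x y) (by positivity)
    (mul_le_of_le_one_left dist_nonneg h1)
  exact ⟨m, a, by rw [b]; ring⟩

/-- Two geodesics from the same point diverge at least linearly. -/
theorem dist_le_of_common {p q r x y : X} {t : ℝ} (h0 : 0 ≤ t) (h1 : t ≤ 1)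
    (hx : dist p x = t * dist p q) (hx' : dist x q = (1 - t) * dist p q)
    (hy : dist p y = t * dist p r) (hy' : dist y r = (1 - t) * dist p r) :
    dist x y ≤ t * dist q r := by
  have k1 := dist_sq_le (p := y) h0 h1 hx hx'
  have k2 := dist_sq_le (p := q) h0 h1 hy hy'
  rw [dist_comm y p, hy, dist_comm y x, dist_comm y q] at k1
  rw [dist_comm q p] at k2
  have : dist x y ^ 2 ≤ (t * dist q r) ^ 2 := by nlinarith
  exact (abs_le_of_sq_le_sq' this (by positivity)).2

theorem dist_ratio_le {x₀ x₁ y₀ y₁ x y : X} {t : ℝ} (h0 : 0 ≤ t) (h1 : t ≤ 1)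
    (hx : dist x₀ x = t * dist x₀ x₁) (hx' : dist x x₁ = (1 - t) * dist x₀ x₁)
    (hy : dist y₀ y = t * dist y₀ y₁) (hy' : dist y y₁ = (1 - t) * dist y₀ y₁) :
    dist x y ≤ (1 - t) * dist x₀ y₀ + t * dist x₁ y₁ := by
  obtain ⟨m, hm, hm'⟩ := exists_ratio_between x₀ y₁ h0 h1
  have k1 := dist_le_of_common h0 h1 hx hx' hm hm'
  have k2 := dist_le_of_common (p := y₁) (q := x₀) (r := y₀) (x := m) (y := y) (t := 1 - t)
    (by linarith) (by linarith) (by rw [dist_comm, hm', dist_comm y₁])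
    (by rw [dist_comm, hm, dist_comm y₁]; ring) (by rw [dist_comm, hy', dist_comm y₁])
    (by rw [dist_comm, hy, dist_comm y₁]; ring)
  linarith [dist_triangle x m y]

/-- If `p` is the point nearest to `x` on the geodesic `[p, s]`, then the angle at `p` is at least
a right angle. -/
theorem add_sq_le_of_nearest {x p s : X}
    (h : ∀ m, dist p m + dist m s = dist p s → dist x p ≤ dist x m) :
    dist x p ^ 2 + dist p s ^ 2 ≤ dist x s ^ 2 := by
  have key : ∀ t : ℝ, 0 < t → t ≤ 1 →
      dist x p ^ 2 + dist p s ^ 2 ≤ dist x s ^ 2 + t * dist p s ^ 2 := by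
    intro t h0 h1
    obtain ⟨m, hm, hm'⟩ := exists_ratio_between p s h0.le h1
    have k := dist_sq_le (p := x) h0.le h1 hm hm'
    have k' : dist x p ^ 2 ≤ dist x m ^ 2 := by
      have := h m (by rw [hm, hm']; ring)
      gcongr
    have : t * (dist x p ^ 2 + dist p s ^ 2) ≤ t * (dist x s ^ 2 + t * dist p s ^ 2) := by nlinarith
    exact le_of_mul_le_mul_left this h0
  apply le_of_forall_pos_le_add
  intro e he
  set B := dist p s ^ 2
  have hB : 0 ≤ B := sq_nonneg _
  have ht : 0 < min 1 (e / (B + 1)) := by positivity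
  have := key _ ht (min_le_left _ _)
  have h2 : min 1 (e / (B + 1)) * B ≤ e := by
    calc min 1 (e / (B + 1)) * B ≤ e / (B + 1) * B := by gcongr; exact min_le_right _ _
      _ = e * (B / (B + 1)) := by ring
      _ ≤ e * 1 := by gcongr; rw [div_le_one (by positivity)]; linarith
      _ = e := mul_one e
  linarith

/-- Closed balls are convex. -/
theorem dist_le_max {x y z m : X} (h : dist y m + dist m z = dist y z) :
    dist x m ≤ max (dist x y) (dist x z) := by
  rcases eq_or_lt_of_le (dist_nonneg (x := y) (y := z)) with h0 | h0
  · have : dist y m = 0 := by linarith [dist_nonneg (x := y) (y := m), dist_nonneg (x := m) (y := z)]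
    rw [dist_eq_zero] at this; subst this; exact le_max_left _ _
  · have hm := dist_nonneg (x := y) (y := m)
    have hm' := dist_nonneg (x := m) (y := z)
    have k := dist_ratio_le (x₀ := x) (x₁ := x) (x := x) (y₀ := y) (y₁ := z) (y := m)
      (t := dist y m / dist y z) (by positivity) (by rw [div_le_one h0]; linarith) (by simp)
      (by simp) (by field_simp) (by field_simp; linarith)
    set t := dist y m / dist y z with ht
    have ht0 : 0 ≤ t := by positivity
    have ht1 : t ≤ 1 := by rw [ht, div_le_one h0]; linarith
    have a1 := le_max_left (dist x y) (dist x z)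
    have a2 := le_max_right (dist x y) (dist x z)
    nlinarith

/-- `g` is an isometric embedding on the set `I` of parameters. -/
def IsGeodOn {X : Type u} [MetricSpace X] (g : ℝ → X) (I : Set ℝ) : Prop :=
  ∀ s ∈ I, ∀ t ∈ I, dist (g s) (g t) = |s - t|

theorem IsGeodOn.mono {X : Type u} [MetricSpace X] {g : ℝ → X} {I J : Set ℝ} (h : IsGeodOn g J)
    (hIJ : I ⊆ J) : IsGeodOn g I :=
  fun s hs t ht => h s (hIJ hs) t (hIJ ht)

theorem isGeodOn_of_isometry {X : Type u} [MetricSpace X] {g : ℝ → X} (h : Isometry g)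
    (I : Set ℝ) : IsGeodOn g I :=
  fun s _ t _ => by rw [h.dist_eq, Real.dist_eq]

theorem IsGeodOn.dist_eq {X : Type u} [MetricSpace X] {g : ℝ → X} {I : Set ℝ} (h : IsGeodOn g I)
    {s t : ℝ} (hs : s ∈ I) (ht : t ∈ I) (hst : s ≤ t) : dist (g s) (g t) = t - s := by
  rw [h s hs t ht, abs_sub_comm, abs_of_nonneg (by linarith)]

theorem IsGeodOn.comp_add {X : Type u} [MetricSpace X] {g : ℝ → X} {I : Set ℝ} (h : IsGeodOn g I)
    (a : ℝ) {J : Set ℝ} (hJ : ∀ t ∈ J, a + t ∈ I) : IsGeodOn (fun t => g (a + t)) J :=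
  fun s hs t ht => by
    show dist (g (a + s)) (g (a + t)) = _
    rw [h _ (hJ s hs) _ (hJ t ht)]; congr 1; ring

theorem IsGeodOn.comp_sub {X : Type u} [MetricSpace X] {g : ℝ → X} {I : Set ℝ} (h : IsGeodOn g I)
    (a : ℝ) {J : Set ℝ} (hJ : ∀ t ∈ J, a - t ∈ I) : IsGeodOn (fun t => g (a - t)) J :=
  fun s hs t ht => by
    show dist (g (a - s)) (g (a - t)) = _
    rw [h _ (hJ s hs) _ (hJ t ht), abs_sub_comm]; congr 1; ring

/-- The distance between two geodesics is a convex function of the parameter. -/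
theorem dist_geod_le {g g' : ℝ → X} {a b t : ℝ} (hg : IsGeodOn g (Icc a b))
    (hg' : IsGeodOn g' (Icc a b)) (hat : a ≤ t) (htb : t ≤ b) (hab : a < b) :
    dist (g t) (g' t) ≤
      (b - t) / (b - a) * dist (g a) (g' a) + (t - a) / (b - a) * dist (g b) (g' b) := by
  have h0 : 0 < b - a := by linarith
  have ma : a ∈ Icc a b := ⟨le_rfl, hab.le⟩
  have mb : b ∈ Icc a b := ⟨hab.le, le_rfl⟩
  have mt : t ∈ Icc a b := ⟨hat, htb⟩
  have k := dist_ratio_le (x₀ := g a) (x₁ := g b) (x := g t) (y₀ := g' a) (y₁ := g' b) (y := g' t)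
    (t := (t - a) / (b - a)) (div_nonneg (by linarith) h0.le)
    (by rw [div_le_one h0]; linarith)
    (by rw [hg.dist_eq ma mt hat, hg.dist_eq ma mb hab.le]; field_simp)
    (by rw [hg.dist_eq mt mb htb, hg.dist_eq ma mb hab.le]; field_simp; ring)
    (by rw [hg'.dist_eq ma mt hat, hg'.dist_eq ma mb hab.le]; field_simp)
    (by rw [hg'.dist_eq mt mb htb, hg'.dist_eq ma mb hab.le]; field_simp; ring)
  have e : 1 - (t - a) / (b - a) = (b - t) / (b - a) := by field_simp; ring
  rwa [e] at k

theorem dist_geod_le_max {g g' : ℝ → X} {a b t : ℝ} (hg : IsGeodOn g (Icc a b))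
    (hg' : IsGeodOn g' (Icc a b)) (hat : a ≤ t) (htb : t ≤ b) :
    dist (g t) (g' t) ≤ max (dist (g a) (g' a)) (dist (g b) (g' b)) := by
  rcases eq_or_lt_of_le (hat.trans htb) with h | h
  · have : t = a := by linarith
    subst this; exact le_max_left _ _
  · have k := dist_geod_le hg hg' hat htb h
    have h0 : 0 < b - a := by linarith
    have a1 := le_max_left (dist (g a) (g' a)) (dist (g b) (g' b))
    have a2 := le_max_right (dist (g a) (g' a)) (dist (g b) (g' b))
    have e : (b - t) / (b - a) + (t - a) / (b - a) = 1 := by field_simp; ring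
    have p1 : 0 ≤ (b - t) / (b - a) := div_nonneg (by linarith) h0.le
    have p2 : 0 ≤ (t - a) / (b - a) := div_nonneg (by linarith) h0.le
    calc dist (g t) (g' t) ≤ _ := k
      _ ≤ (b - t) / (b - a) * max (dist (g a) (g' a)) (dist (g b) (g' b)) +
          (t - a) / (b - a) * max (dist (g a) (g' a)) (dist (g b) (g' b)) := by gcongr
      _ = _ := by rw [← add_mul, e, one_mul]

/-- A geodesic segment with prescribed endpoints. -/
theorem exists_geod (x y : X) : ∃ g : ℝ → X, g 0 = x ∧ g (dist x y) = y ∧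
    IsGeodOn g (Icc 0 (dist x y)) :=
  CAT0Space.exists_geodesic x y

theorem eq_of_between {x y m n : X} (hm : dist x m + dist m y = dist x y)
    (hn : dist x n = dist x m) (hn' : dist n y = dist m y) : m = n := by
  rcases eq_or_lt_of_le (dist_nonneg (x := x) (y := y)) with h0 | h0
  · have e1 : dist x m = 0 := by
      linarith [dist_nonneg (x := x) (y := m), dist_nonneg (x := m) (y := y)]
    rw [e1] at hn
    exact (dist_eq_zero.1 e1).symm.trans (dist_eq_zero.1 hn)
  · have p1 := dist_nonneg (x := x) (y := m)
    have p2 := dist_nonneg (x := m) (y := y)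
    have k := dist_ratio_le (x₀ := x) (x₁ := y) (x := m) (y₀ := x) (y₁ := y) (y := n)
      (t := dist x m / dist x y) (by positivity) (by rw [div_le_one h0]; linarith)
      (by field_simp) (by field_simp; linarith) (by rw [hn]; field_simp)
      (by rw [hn']; field_simp; linarith)
    simp only [dist_self, mul_zero, add_zero] at k
    exact dist_le_zero.1 k

/-! ### Contracting sets and the Morse lemma -/

section Contracting

variable {X : Type u} [MetricSpace X]

/-- A nonempty closed `D`-contracting set. -/
structure ContractingSet (D : ℝ≥0) (S : Set X) : Prop where
  closed : IsClosed S
  nonempty : S.Nonempty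
  contracting : IsContracting D S

open Classical in
/-- A choice of nearest point projection to `S`. -/
noncomputable def proj (S : Set X) (x : X) : X :=
  if h : ∃ p, IsNearestPoint S x p then h.choose else x

theorem exists_isNearestPoint [ProperSpace X] {S : Set X} (hS : IsClosed S) (hne : S.Nonempty)
    (x : X) : ∃ p, IsNearestPoint S x p := by
  obtain ⟨p, hp, e⟩ := hS.exists_infDist_eq_dist hne x
  exact ⟨p, hp, fun q hq => e ▸ Metric.infDist_le_dist_of_mem hq⟩

theorem _root_.IsNearestPoint.dist_eq {S : Set X} {x p : X} (h : IsNearestPoint S x p) :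
    dist x p = Metric.infDist x S :=
  le_antisymm ((Metric.le_infDist ⟨p, h.1⟩).2 fun {q} hq => h.2 q hq)
    (Metric.infDist_le_dist_of_mem h.1)

/-- A quasi-geodesic on the set `I` of parameters. -/
def IsQGeodOn (L E : ℝ) (c : ℝ → X) (I : Set ℝ) : Prop :=
  ∀ s ∈ I, ∀ t ∈ I, dist (c s) (c t) ≤ L * |s - t| + E ∧ |s - t| ≤ L * dist (c s) (c t) + E

theorem IsQGeodOn.mono {L E : ℝ} {c : ℝ → X} {I J : Set ℝ} (h : IsQGeodOn L E c J)
    (hIJ : I ⊆ J) : IsQGeodOn L E c I :=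
  fun s hs t ht => h s (hIJ hs) t (hIJ ht)

theorem IsQGeodOn.comp_neg {L E : ℝ} {c : ℝ → X} {I J : Set ℝ} (h : IsQGeodOn L E c J)
    (hIJ : ∀ t ∈ I, -t ∈ J) : IsQGeodOn L E (fun t => c (-t)) I := by
  intro s hs t ht
  have := h _ (hIJ s hs) _ (hIJ t ht)
  rwa [show -s - -t = -(s - t) by ring, abs_neg] at this

theorem ContractingSet.dist_le_of_lt {D : ℝ≥0} {S : Set X} (hS : ContractingSet D S) {x y p q : X}
    (hxy : dist x y < Metric.infDist x S) (hp : IsNearestPoint S x p) (hq : IsNearestPoint S y q) :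
    dist p q ≤ D := by
  refine hS.contracting x (Metric.infDist x S) Metric.disjoint_ball_infDist x ?_ y ?_ p q hp hq
  · exact Metric.mem_ball_self (dist_nonneg.trans_lt hxy)
  · rwa [Metric.mem_ball, dist_comm]

variable [ProperSpace X] {D : ℝ≥0} {S : Set X}

theorem ContractingSet.proj_spec (hS : ContractingSet D S) (x : X) :
    IsNearestPoint S x (proj S x) := by
  have h := exists_isNearestPoint hS.closed hS.nonempty x
  rw [proj, dif_pos h]
  exact h.choose_spec

theorem ContractingSet.dist_proj (hS : ContractingSet D S) (x : X) :
    dist x (proj S x) = Metric.infDist x S :=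
  (hS.proj_spec x).dist_eq

theorem ContractingSet.dist_proj_proj_le (hS : ContractingSet D S) {x y : X}
    (hxy : dist x y < Metric.infDist x S) : dist (proj S x) (proj S y) ≤ D :=
  hS.dist_le_of_lt hxy (hS.proj_spec x) (hS.proj_spec y)

/-- Along a chain whose steps are shorter than the distance to `S`, the projection to `S` moves by
at most `D` with each step. -/
theorem ContractingSet.chain (hS : ContractingSet D S) (c : ℕ → X) (n : ℕ)
    (h : ∀ i < n, dist (c i) (c (i + 1)) < Metric.infDist (c i) S) :
    dist (proj S (c 0)) (proj S (c n)) ≤ n * D := by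
  induction n with
  | zero => simp
  | succ n ih =>
    have h1 := ih fun i hi => h i (by omega)
    have h2 := hS.dist_proj_proj_le (h n (by omega))
    have := dist_triangle (proj S (c 0)) (proj S (c n)) (proj S (c (n + 1)))
    push_cast
    linarith

/-- Following a quasi-geodesic with steps of length `τ` until it comes back near `S`. -/
theorem ContractingSet.exists_return (hS : ContractingSet D S) {L E M τ : ℝ} (hL : 1 ≤ L)
    (hτ : 1 ≤ τ) (hM : L * τ + E < M) {c : ℝ → X} {b : ℝ} {t : ℝ} (htb : t ≤ b)
    (hc : IsQGeodOn L E c (Icc t b)) (hb : Metric.infDist (c b) S ≤ M) :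
    ∃ (n : ℕ) (t' : ℝ), t' ∈ Icc t b ∧ Metric.infDist (c t') S ≤ M ∧
      dist (proj S (c t)) (proj S (c t')) ≤ n * D ∧ t' - t ≤ n * τ ∧ (n - 1) * τ ≤ t' - t := by
  classical
  set s : ℕ → ℝ := fun i => min (t + i * τ) b with hs
  have hsI : ∀ i, s i ∈ Icc t b := fun i => by
    refine ⟨le_min ?_ htb, min_le_right _ _⟩
    have : 0 ≤ (i : ℝ) * τ := by positivity
    linarith
  have hex : ∃ n, Metric.infDist (c (s n)) S ≤ M := by
    obtain ⟨n, hn⟩ := exists_nat_ge (b - t)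
    refine ⟨n, ?_⟩
    have : s n = b := min_eq_right (by nlinarith [(Nat.cast_nonneg n : (0 : ℝ) ≤ n)])
    rwa [this]
  set n := Nat.find hex with hn
  have hn1 : Metric.infDist (c (s n)) S ≤ M := Nat.find_spec hex
  have hn2 : ∀ i < n, M < Metric.infDist (c (s i)) S := fun i hi =>
    not_le.1 (Nat.find_min hex hi)
  have s0 : s 0 = t := by simp [hs, htb]
  refine ⟨n, s n, hsI n, hn1, ?_, ?_, ?_⟩
  · have := hS.chain (fun i => c (s i)) n (fun i hi => by
      have k := (hc _ (hsI i) _ (hsI (i + 1))).1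
      have : |s i - s (i + 1)| ≤ τ := by
        have h1 : |s i - s (i + 1)| ≤ |(t + i * τ) - (t + (i + 1 : ℕ) * τ)| := by
          have := abs_min_sub_min_le_max (t + i * τ) b (t + (i + 1 : ℕ) * τ) b
          simpa [hs] using this
        refine h1.trans ?_
        push_cast
        rw [show t + i * τ - (t + (i + 1) * τ) = -τ by ring, abs_neg, abs_of_nonneg (by linarith)]
      have : L * |s i - s (i + 1)| ≤ L * τ := by gcongr
      linarith [hn2 i hi])
    simpa [s0] using this
  · have : s n ≤ t + n * τ := min_le_left _ _
    linarith
  · rcases Nat.eq_zero_or_pos n with h0 | h0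
    · rw [h0, s0]; push_cast; linarith
    · have h1 := hn2 (n - 1) (by omega)
      have h2 : t + (n - 1 : ℕ) * τ < b := by
        by_contra hcon
        have : s (n - 1) = b := min_eq_right (not_lt.1 hcon)
        rw [this] at h1; linarith
      rw [Nat.cast_sub h0] at h2
      push_cast at h2
      have : t + (n - 1) * τ ≤ s n := le_min (by nlinarith) h2.le
      linarith

/-- The Morse lemma: a quasi-geodesic segment with endpoints near a contracting set stays near
this set. -/
theorem morse_segment (X : Type u) [MetricSpace X] [ProperSpace X] (D : ℝ≥0) {L E : ℝ} (R : ℝ)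
    (hL : 1 ≤ L) (hE : 0 ≤ E) :
    ∃ N : ℝ, 0 ≤ N ∧ ∀ S : Set X, ContractingSet D S → ∀ (c : ℝ → X) (a b : ℝ),
      IsQGeodOn L E c (Icc a b) → Metric.infDist (c a) S ≤ R → Metric.infDist (c b) S ≤ R →
      ∀ t ∈ Icc a b, Metric.infDist (c t) S ≤ N := by
  -- The step `τ` is so long that the projection moves by at most `τ / (2 * L)` with each step: a
  -- long excursion from `S` would be a shortcut.
  set τ : ℝ := 2 * L * D + 1 with hτ
  have hD : (0 : ℝ) ≤ D := D.2
  have hτ1 : 1 ≤ τ := by rw [hτ]; nlinarith [mul_nonneg (by linarith : (0:ℝ) ≤ L) hD]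
  set M : ℝ := max (L * τ + E + 1) R with hMdef
  have hM1 : L * τ + E < M := lt_of_lt_of_le (by linarith) (le_max_left _ _)
  have hM0 : 0 ≤ M := by nlinarith
  refine ⟨M + E + L * (4 * τ + 2 * (2 * L * M + E)), by positivity, ?_⟩
  intro S hS c a b hc ha hb t ht
  have hRM : R ≤ M := le_max_right _ _
  obtain ⟨n, t₁, ht₁, i₁, p₁, u₁, l₁⟩ := hS.exists_return hL hτ1 hM1 ht.2
    (hc.mono (Icc_subset_Icc_left ht.1)) (hb.trans hRM)
  obtain ⟨m, t₂, ht₂, i₂, p₂, u₂, l₂⟩ := hS.exists_return (c := fun s => c (-s)) (t := -t)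
    (b := -a) hL hτ1 hM1 (by linarith [ht.1])
    (hc.comp_neg (fun s hs => ⟨by linarith [hs.2], by linarith [hs.1, ht.2]⟩))
    (by simpa using ha.trans hRM)
  simp only [neg_neg] at p₂
  have q₁ := hS.dist_proj (c t₁)
  have q₂ := hS.dist_proj (c (-t₂))
  have d12 : dist (c t₁) (c (-t₂)) ≤ 2 * M + (n + m) * D := by
    have e1 := dist_triangle4 (c t₁) (proj S (c t₁)) (proj S (c (-t₂))) (c (-t₂))
    have e2 := dist_triangle_left (proj S (c t₁)) (proj S (c (-t₂))) (proj S (c t))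
    rw [dist_comm (proj S (c (-t₂))) (c (-t₂))] at e1
    linarith
  have k := (hc t₁ ⟨by linarith [ht.1, ht₁.1], ht₁.2⟩ (-t₂)
    ⟨by linarith [ht₂.2], by linarith [ht₂.1, ht.2]⟩).2
  have k2 : L * dist (c t₁) (c (-t₂)) ≤ L * (2 * M + (n + m) * D) := by gcongr
  have k3 := le_abs_self (t₁ - -t₂)
  have hnm : (0 : ℝ) ≤ n + m := by positivity
  have k4 : L * ((n + m) * D) ≤ (n + m) * τ / 2 := by rw [hτ]; nlinarith
  have k5 : (n + m) * τ ≤ 4 * τ + 2 * (2 * L * M + E) := by nlinarith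
  have k6 : t₁ - t ≤ 4 * τ + 2 * (2 * L * M + E) := by
    have : (0 : ℝ) ≤ m * τ := by positivity
    linarith
  have k7 := (hc t ht t₁ ⟨by linarith [ht.1, ht₁.1], ht₁.2⟩).1
  rw [abs_sub_comm, abs_of_nonneg (by linarith [ht₁.1])] at k7
  have k8 := Metric.infDist_le_infDist_add_dist (s := S) (x := c t) (y := c t₁)
  have k9 : L * (t₁ - t) ≤ L * (4 * τ + 2 * (2 * L * M + E)) := by gcongr
  linarith

/-- A quasi-geodesic ray at bounded distance from a contracting set comes uniformly close to this
set. -/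
theorem ContractingSet.exists_close (hS : ContractingSet D S) {L E : ℝ} (hL : 1 ≤ L)
    {c : ℝ → X} {t K : ℝ} (hc : IsQGeodOn L E c (Ici t))
    (hK : ∀ s ∈ Ici t, Metric.infDist (c s) S ≤ K) :
    ∃ s ∈ Ici t, Metric.infDist (c s) S ≤ L * (2 * L * D + 1) + E + 1 := by
  by_contra hcon
  push Not at hcon
  have hD : (0 : ℝ) ≤ D := D.2
  set τ : ℝ := 2 * L * D + 1 with hτ
  have hτ1 : 1 ≤ τ := by rw [hτ]; nlinarith [mul_nonneg (by linarith : (0:ℝ) ≤ L) hD]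
  have hmem : ∀ n : ℕ, t + n * τ ∈ Ici t := fun n => by
    have : (0 : ℝ) ≤ n * τ := by positivity
    simp only [mem_Ici]; linarith
  have key : ∀ n : ℕ, (n : ℝ) * τ ≤ 2 * (2 * L * K + E) := by
    intro n
    have k1 := hS.chain (fun i => c (t + i * τ)) n (fun i _ => by
      have k := (hc _ (hmem i) _ (hmem (i + 1))).1
      have e : |t + i * τ - (t + (i + 1 : ℕ) * τ)| = τ := by
        push_cast
        rw [show t + i * τ - (t + (i + 1) * τ) = -τ by ring, abs_neg, abs_of_nonneg (by linarith)]
      rw [e] at k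
      linarith [hcon _ (hmem i)])
    simp only [Nat.cast_zero, zero_mul, add_zero] at k1
    have k2 := (hc _ (hmem n) t self_mem_Ici).2
    rw [add_sub_cancel_left, abs_of_nonneg (by positivity)] at k2
    have e1 := dist_triangle4 (c (t + n * τ)) (proj S (c (t + n * τ))) (proj S (c t)) (c t)
    rw [hS.dist_proj, dist_comm (proj S (c t)) (c t), hS.dist_proj,
      dist_comm (proj S (c (t + n * τ)))] at e1
    have e2 := hK _ (hmem n)
    have e3 := hK _ (self_mem_Ici (a := t))
    have e4 : dist (c (t + n * τ)) (c t) ≤ 2 * K + n * D := by linarith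
    have e5 : L * dist (c (t + n * τ)) (c t) ≤ L * (2 * K + n * D) := by gcongr
    have e6 : L * (n * D) ≤ n * τ / 2 := by rw [hτ]; nlinarith [(Nat.cast_nonneg n : (0:ℝ) ≤ n)]
    nlinarith
  obtain ⟨n, hn⟩ := exists_nat_gt (2 * (2 * L * K + E))
  nlinarith [key n, (Nat.cast_nonneg n : (0:ℝ) ≤ n)]

/-- The Morse lemma for bi-infinite quasi-geodesics. -/
theorem morse_line (X : Type u) [MetricSpace X] [ProperSpace X] (D : ℝ≥0) {L E : ℝ}
    (hL : 1 ≤ L) (hE : 0 ≤ E) :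
    ∃ N : ℝ, 0 ≤ N ∧ ∀ S : Set X, ContractingSet D S → ∀ (c : ℝ → X) (K : ℝ),
      IsQGeodOn L E c univ → (∀ t, Metric.infDist (c t) S ≤ K) →
      ∀ t, Metric.infDist (c t) S ≤ N := by
  obtain ⟨N, hN, h⟩ := morse_segment X D (L * (2 * L * D + 1) + E + 1) hL hE
  refine ⟨N, hN, fun S hS c K hc hK t => ?_⟩
  obtain ⟨b, hb, hb'⟩ := hS.exists_close hL (hc.mono (subset_univ (Ici t))) fun s _ => hK s
  obtain ⟨a, ha, ha'⟩ := hS.exists_close (c := fun s => c (-s)) (t := -t) (K := K) hL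
    (hc.comp_neg fun _ _ => mem_univ _) fun s _ => hK _
  simp only [mem_Ici] at hb ha
  exact h S hS c (-a) b (hc.mono (subset_univ _)) ha' hb' t ⟨by linarith, hb⟩

/-- A geodesic that stays away from a contracting set has a projection of bounded size. -/
theorem ContractingSet.dist_proj_le_of_far (hS : ContractingSet D S) {g : ℝ → X} {a b : ℝ}
    (hab : a ≤ b) (hg : IsGeodOn g (Icc a b))
    (hfar : ∀ t ∈ Icc a b, 2 * (D : ℝ) + 1 < Metric.infDist (g t) S) :
    dist (proj S (g a)) (proj S (g b)) ≤ 6 * D + 2 := by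
  have hD : (0 : ℝ) ≤ D := D.2
  have ma : a ∈ Icc a b := ⟨le_rfl, hab⟩
  have mb : b ∈ Icc a b := ⟨hab, le_rfl⟩
  set ra := Metric.infDist (g a) S with hra
  set rb := Metric.infDist (g b) S with hrb
  have ha := hfar a ma
  have hb := hfar b mb
  rw [← hra] at ha
  rw [← hrb] at hb
  have hlen := hg.dist_eq ma mb hab
  rcases lt_or_ge (b - a) (ra + rb - 1) with hlt | hge
  · rcases lt_or_ge (b - a) ra with h2 | h2
    · have := hS.dist_proj_proj_le (x := g a) (y := g b) (by rw [hlen]; exact h2)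
      linarith
    · have mm : a + ra - 1 / 2 ∈ Icc a b := ⟨by linarith, by linarith⟩
      have k1 := hS.dist_proj_proj_le (x := g a) (y := g (a + ra - 1 / 2)) (by
        rw [hg.dist_eq ma mm mm.1]; linarith)
      have k2 := hS.dist_proj_proj_le (x := g b) (y := g (a + ra - 1 / 2)) (by
        rw [dist_comm, hg.dist_eq mm mb mm.2]; linarith)
      have := dist_triangle_right (proj S (g a)) (proj S (g b)) (proj S (g (a + ra - 1 / 2)))
      linarith
  · -- Off the two large balls around the endpoints, the geodesic has length at most
    -- `d (πa, πb) + 1`, and it is covered by steps of length `2 * D + 1`.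
    set u := a + ra - 1 / 2 with hu
    set w := b - rb + 1 / 2 with hw
    have mu : u ∈ Icc a b := ⟨by linarith, by linarith⟩
    have mw : w ∈ Icc a b := ⟨by linarith, by linarith⟩
    have huw : u ≤ w := by linarith
    have k1 := hS.dist_proj_proj_le (x := g a) (y := g u) (by
        rw [hg.dist_eq ma mu mu.1]; linarith)
    have k2 := hS.dist_proj_proj_le (x := g b) (y := g w) (by
        rw [dist_comm, hg.dist_eq mw mb mw.2]; linarith)
    set A : ℝ := 2 * D + 1 with hA
    have hA0 : 0 < A := by linarith
    obtain ⟨n, hn1, hn2⟩ : ∃ n : ℕ, w ≤ u + n * A ∧ (n : ℝ) * A ≤ w - u + A := by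
      refine ⟨⌈(w - u) / A⌉₊, ?_, ?_⟩
      · have := Nat.le_ceil ((w - u) / A)
        rw [div_le_iff₀ hA0] at this; linarith
      · have := (Nat.ceil_lt_add_one (div_nonneg (sub_nonneg.2 huw) hA0.le)).le
        calc (⌈(w - u) / A⌉₊ : ℝ) * A ≤ ((w - u) / A + 1) * A := by gcongr
          _ = _ := by field_simp
    have hmem : ∀ i : ℕ, min (u + i * A) w ∈ Icc a b := fun i =>
      ⟨le_min (by have : (0:ℝ) ≤ i * A := by positivity
                  linarith [mu.1]) mw.1, (min_le_right _ _).trans mw.2⟩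
    have k3 := hS.chain (fun i => g (min (u + i * A) w)) n (fun i _ => by
      rw [hg _ (hmem i) _ (hmem (i + 1))]
      refine lt_of_le_of_lt ?_ (hfar _ (hmem i))
      have h1 := abs_min_sub_min_le_max (u + i * A) w (u + (i + 1 : ℕ) * A) w
      rw [sub_self, abs_zero, max_eq_left (abs_nonneg _)] at h1
      refine h1.trans ?_
      push_cast
      rw [show u + i * A - (u + (i + 1) * A) = -A by ring, abs_neg, abs_of_nonneg hA0.le])
    simp only [Nat.cast_zero, zero_mul, add_zero, min_eq_left huw, min_eq_right hn1] at k3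
    have e1 := dist_triangle4 (g a) (proj S (g a)) (proj S (g b)) (g b)
    rw [hS.dist_proj, dist_comm (proj S (g b)) (g b), hS.dist_proj, hlen] at e1
    have e2 := dist_triangle4 (proj S (g a)) (proj S (g u)) (proj S (g w)) (proj S (g b))
    rw [dist_comm (proj S (g w))] at e2
    have e3 : (n : ℝ) * D ≤ (n * A) / 2 := by
      rw [hA]; nlinarith [(Nat.cast_nonneg n : (0:ℝ) ≤ n)]
    linarith

/-- If a geodesic from `g a` comes close to a contracting set, then it passes near the projection
of `g a`. -/
theorem ContractingSet.exists_near_proj (hS : ContractingSet D S) {g : ℝ → X} {a b : ℝ}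
    (hg : IsGeodOn g (Icc a b))
    (hnear : ∃ t ∈ Icc a b, Metric.infDist (g t) S ≤ 2 * (D : ℝ) + 1) :
    ∃ u ∈ Icc a b, dist (g u) (proj S (g a)) ≤ 8 * D + 4 := by
  have hD : (0 : ℝ) ≤ D := D.2
  set A : ℝ := 2 * D + 1 with hA
  obtain ⟨t₀, m₀, h₀⟩ := hnear
  have hab : a ≤ b := m₀.1.trans m₀.2
  set T : Set ℝ := {t | t ∈ Icc a b ∧ Metric.infDist (g t) S ≤ A} with hT
  have hTne : T.Nonempty := ⟨t₀, m₀, h₀⟩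
  have hTbdd : BddBelow T := ⟨a, fun t ht => ht.1.1⟩
  have ha : a ≤ sInf T := le_csInf hTne fun t ht => ht.1.1
  obtain ⟨t₁, ht₁, ht₁'⟩ := Real.lt_sInf_add_pos hTne (ε := 1 / 2) (by norm_num)
  have hs₁ : sInf T ≤ t₁ := csInf_le hTbdd ht₁
  set t₂ := max a (sInf T - 1 / 2) with ht₂
  have h21 : t₂ ≤ sInf T := max_le ha (by linarith)
  have hm₂ : t₂ ∈ Icc a b := ⟨le_max_left _ _, (h21.trans hs₁).trans ht₁.1.2⟩
  have hd : dist (g t₂) (g t₁) ≤ 1 := by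
    rw [hg.dist_eq hm₂ ht₁.1 (h21.trans hs₁)]
    linarith [le_max_right a (sInf T - 1 / 2)]
  have hi : Metric.infDist (g t₂) S ≤ A + 1 := by
    have := Metric.infDist_le_infDist_add_dist (s := S) (x := g t₂) (y := g t₁)
    linarith [ht₁.2]
  refine ⟨t₂, hm₂, ?_⟩
  have hp : dist (proj S (g a)) (proj S (g t₂)) ≤ 6 * D + 2 := by
    rcases le_or_gt (sInf T - 1 / 2) a with hle | hlt
    · rw [ht₂, max_eq_left hle, dist_self]; linarith
    · have e : t₂ = sInf T - 1 / 2 := max_eq_right hlt.le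
      refine hS.dist_proj_le_of_far hm₂.1 (hg.mono (Icc_subset_Icc_right hm₂.2)) fun t ht => ?_
      by_contra hcon
      have : sInf T ≤ t := csInf_le hTbdd ⟨⟨ht.1, ht.2.trans hm₂.2⟩, not_lt.1 hcon⟩
      linarith [ht.2]
  have := dist_triangle_right (g t₂) (proj S (g a)) (proj S (g t₂))
  rw [hS.dist_proj] at this
  linarith

end Contracting

/-! ### Contraction from the Morse property, and its transport by quasi-isometries -/

section Slim

variable {X : Type u} [MetricSpace X]

/-- A set that contains all geodesics between its points. -/
def GeodConvex (S : Set X) : Prop :=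
  ∀ p ∈ S, ∀ q ∈ S, ∀ m, dist p m + dist m q = dist p q → m ∈ S

/-- The point of a geodesic `[x, q]` that is nearest to `p`. -/
theorem exists_nearest_between [ProperSpace X] (p x q : X) : ∃ z, dist x z + dist z q = dist x q ∧
    ∀ m, dist x m + dist m q = dist x q → dist p z ≤ dist p m := by
  have hc : IsClosed {m : X | dist x m + dist m q = dist x q} :=
    isClosed_eq (by fun_prop) (by fun_prop)
  obtain ⟨z, hz, h⟩ := exists_isNearestPoint hc ⟨x, by simp⟩ p
  exact ⟨z, hz, h⟩

variable [CAT0Space X]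

theorem add_sq_le_of_isNearestPoint {S : Set X} (hS : GeodConvex S) {x p w : X}
    (hp : IsNearestPoint S x p) (hw : w ∈ S) :
    dist x p ^ 2 + dist p w ^ 2 ≤ dist x w ^ 2 :=
  add_sq_le_of_nearest fun m hm => hp.2 m (hS p hp.1 w hw m hm)

/-- A set `S` is `N`-Morse for the concatenations of `[p, z]` and `[z, q]`, where `p` and `q`
belong to `S` and `z` is the point nearest to `p` on a geodesic from some point to `q`: the
corner `z` is `N`-close to `S`. -/
def CornerMorse (N : ℝ) (S : Set X) : Prop :=
  ∀ p ∈ S, ∀ q ∈ S, ∀ x z, dist x z + dist z q = dist x q →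
    (∀ m, dist x m + dist m q = dist x q → dist p z ≤ dist p m) → ∃ w ∈ S, dist z w ≤ N

theorem corner_sq_le {N : ℝ} {S : Set X} (hS : GeodConvex S) {x p q z w : X}
    (hp : IsNearestPoint S x p) (hz : dist x z + dist z q = dist x q)
    (hzm : ∀ m, dist x m + dist m q = dist x q → dist p z ≤ dist p m) (hw : w ∈ S)
    (hzw : dist z w ≤ N) :
    dist p z ^ 2 ≤ N * (dist x p + dist p z) ∧ dist x z ≤ dist x p := by
  have hN : 0 ≤ N := dist_nonneg.trans hzw
  have a1 : dist p z ^ 2 + dist z x ^ 2 ≤ dist p x ^ 2 := by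
    refine add_sq_le_of_nearest fun m hm => hzm m ?_
    refine le_antisymm ?_ (dist_triangle _ _ _)
    rw [dist_comm z m, dist_comm m x, dist_comm z x] at hm
    linarith [dist_triangle m z q, dist_comm m z]
  rw [dist_comm z x, dist_comm p x] at a1
  have a2 := add_sq_le_of_isNearestPoint hS hp hw
  have p1 := dist_nonneg (x := p) (y := z)
  have p2 := dist_nonneg (x := x) (y := p)
  have p3 := dist_nonneg (x := x) (y := z)
  have p4 := dist_nonneg (x := x) (y := w)
  have hxz : dist x z ≤ dist x p := by
    refine (abs_le_of_sq_le_sq' ?_ p2).2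
    nlinarith
  refine ⟨?_, hxz⟩
  rcases le_or_gt (dist p z) N with h | h
  · nlinarith
  · have b1 : dist p z - N ≤ dist p w := by linarith [dist_triangle_right p z w]
    have b2 : dist x w ≤ dist x z + N := by linarith [dist_triangle x z w]
    have b3 : (dist p z - N) ^ 2 ≤ dist p w ^ 2 := by gcongr
    have b4 : dist x w ^ 2 ≤ (dist x z + N) ^ 2 := by gcongr
    nlinarith

/-- The concatenation of `[p, z]` and `[z, q]` is a `3`-quasi-geodesic if `z` is the point
of `[z, q]` nearest to `p`. -/
theorem exists_corner_path {p z q : X}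
    (h : ∀ m, dist z m + dist m q = dist z q → dist p z ≤ dist p m) :
    ∃ σ : ℝ → X, σ 0 = p ∧ σ (dist p z) = z ∧ σ (dist p z + dist z q) = q ∧
      ∀ s ∈ Icc 0 (dist p z + dist z q), ∀ t ∈ Icc 0 (dist p z + dist z q),
        dist (σ s) (σ t) ≤ |s - t| ∧ |s - t| ≤ 3 * dist (σ s) (σ t) := by
  obtain ⟨g, g0, g1, hg⟩ := exists_geod p z
  obtain ⟨g', g0', g1', hg'⟩ := exists_geod z q
  set a := dist p z with ha
  set b := dist z q with hb
  have ha0 : 0 ≤ a := dist_nonneg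
  have hb0 : 0 ≤ b := dist_nonneg
  set σ : ℝ → X := fun t => if t ≤ a then g t else g' (t - a) with hσ
  have s1 : ∀ t, t ≤ a → σ t = g t := fun t ht => if_pos ht
  have s2 : ∀ t, a ≤ t → σ t = g' (t - a) := fun t ht => by
    rcases eq_or_lt_of_le ht with h | h
    · subst h; rw [s1 _ le_rfl, g1, sub_self, g0']
    · exact if_neg (not_le.2 h)
  have key : ∀ s t, 0 ≤ s → s ≤ t → t ≤ a + b →
      dist (σ s) (σ t) ≤ |s - t| ∧ |s - t| ≤ 3 * dist (σ s) (σ t) := by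
    intro s t hs hst ht
    rcases le_total t a with h1 | h1
    · rw [s1 s (hst.trans h1), s1 t h1, hg s ⟨hs, hst.trans h1⟩ t ⟨hs.trans hst, h1⟩]
      exact ⟨le_rfl, by linarith [abs_nonneg (s - t)]⟩
    rcases le_total a s with h2 | h2
    · rw [s2 s h2, s2 t h1, hg' (s - a) ⟨by linarith, by linarith⟩ (t - a)
        ⟨by linarith, by linarith⟩, show s - a - (t - a) = s - t by ring]
      exact ⟨le_rfl, by linarith [abs_nonneg (s - t)]⟩
    · rw [s1 s h2, s2 t h1, abs_sub_comm, abs_of_nonneg (by linarith)]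
      have e1 : dist (g s) z = a - s := by
        rw [← g1]; exact hg.dist_eq ⟨hs, h2⟩ ⟨ha0, le_rfl⟩ h2
      have e2 : dist z (g' (t - a)) = t - a := by
        rw [← g0', hg'.dist_eq ⟨le_rfl, hb0⟩ ⟨by linarith, by linarith⟩ (by linarith), sub_zero]
      have e3 : dist p (g s) = s := by
        rw [← g0, hg.dist_eq ⟨le_rfl, ha0⟩ ⟨hs, h2⟩ hs, sub_zero]
      have e4 : dist (g' (t - a)) q = b - (t - a) := by
        rw [← g1', hg'.dist_eq ⟨by linarith, by linarith⟩ ⟨hb0, le_rfl⟩ (by linarith)]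
      have e5 := h (g' (t - a)) (by rw [e2, e4]; ring)
      have e6 := dist_triangle p (g s) (g' (t - a))
      have e7 := dist_triangle (g s) z (g' (t - a))
      have e8 := dist_triangle_left z (g' (t - a)) (g s)
      constructor <;> linarith
  refine ⟨σ, by rw [s1 _ ha0, g0], by rw [s1 _ le_rfl, g1], by
    rw [s2 _ (by linarith), add_sub_cancel_left, g1'], fun s hs t ht => ?_⟩
  rcases le_total s t with h | h
  · exact key s t hs.1 h ht.2
  · rw [dist_comm, abs_sub_comm]
    exact key t s ht.1 h hs.2

variable [ProperSpace X]

/-- If geodesics from `x` to `S` pass near the projection of `x`, then `S` is contracting. -/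
theorem isContracting_of_slim {S : Set X} (hc : IsClosed S) (hne : S.Nonempty) {δ : ℝ}
    (hslim : ∀ x p q, IsNearestPoint S x p → q ∈ S →
      ∃ z, dist x z + dist z q = dist x q ∧ dist z p ≤ δ) {D' : ℝ≥0} (hD : 6 * δ ≤ D') :
    IsContracting D' S := by
  have key : ∀ x y o p, IsNearestPoint S x o → IsNearestPoint S y p → dist x y < dist x o →
      dist o p ≤ 3 * δ := by
    intro x y o p ho hp hxy
    by_contra! hL
    obtain ⟨z, hz, hz'⟩ := hslim x o p ho hp.1
    obtain ⟨z', hy, hy'⟩ := hslim y p o hp ho.1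
    have k := dist_le_max (x := x) hy
    have e1 := dist_triangle x z o
    have e2 := dist_triangle_left o p z
    have e3 := dist_triangle x z' p
    rcases le_max_iff.1 k with h | h <;> linarith
  intro x r hdisj y hy z hz p q hp hq
  obtain ⟨o, ho⟩ := exists_isNearestPoint hc hne x
  have hr : r ≤ dist x o := by
    by_contra! hlt
    exact (disjoint_left.1 hdisj) (by rwa [Metric.mem_ball, dist_comm]) ho.1
  rw [Metric.mem_ball, dist_comm] at hy hz
  have k1 := key x y o p ho hp (hy.trans_le hr)
  have k2 := key x z o q ho hq (hz.trans_le hr)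
  have := dist_triangle_left p q o
  linarith

/-- The final computation of `slim_of_cornerMorse`: here `r`, `L`, `b`, `e` are the sides `xp`,
`pw`, `xw` and the segment `yw`, and `κ` is the distance from `p` to `[y, w]`. -/
theorem corner_algebra {r L N κ b e : ℝ} (hr : L < r) (hLN : N < L) (hN : 0 ≤ N) (hκL : κ ≤ L) (h1 : κ ^ 2 ≤ N * (L + κ)) (h2 : 2 * (L - κ) ≤ e)
    (st : e ^ 2 ≤ (1 - L / r) * L ^ 2 + L / r * b ^ 2 - L / r * (1 - L / r) * r ^ 2)
    (hb : 0 ≤ b) (h3 : b ≤ r + N) : L ≤ 34 * N := by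
  have hL0 : 0 < L := by linarith
  have hr0 : 0 < r := by linarith
  have st2 : r * e ^ 2 ≤ (r - L) * L ^ 2 + L * b ^ 2 - L * (r - L) * r := by
    have := mul_le_mul_of_nonneg_left st hr0.le
    refine this.trans (le_of_eq ?_)
    field_simp
  have c4 : (2 * (L - κ)) ^ 2 ≤ e ^ 2 := pow_le_pow_left₀ (by linarith) h2 2
  have c6 : b ^ 2 ≤ (r + N) ^ 2 := pow_le_pow_left₀ hb h3 2
  have st3 : r * (2 * (L - κ)) ^ 2 ≤
      (r - L) * L ^ 2 + L * (r + N) ^ 2 - L * (r - L) * r := by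
    have h1 := mul_le_mul_of_nonneg_left c4 hr0.le
    have h2 := mul_le_mul_of_nonneg_left c6 hL0.le
    linarith
  have st4 : L * (2 * r * L + L ^ 2) ≤ L * (8 * r * κ + 2 * r * N + N ^ 2) := by
    have := mul_nonneg hr0.le (sq_nonneg κ)
    linarith
  have st5 := le_of_mul_le_mul_left st4 hL0
  have st6 : r * L ≤ r * (4 * κ + N) := by
    have : N ^ 2 ≤ L ^ 2 := pow_le_pow_left₀ hN hLN.le 2
    linarith
  have st7 := le_of_mul_le_mul_left st6 hr0
  have st8 : (L - N) ^ 2 ≤ (4 * κ) ^ 2 := pow_le_pow_left₀ (by linarith) (by linarith) 2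
  have st9 : N * κ ≤ N * L := mul_le_mul_of_nonneg_left hκL hN
  have st10 : L * L ≤ L * (34 * N) := by linarith [sq_nonneg N]
  exact le_of_mul_le_mul_left st10 hL0

/-- In a CAT(0) space, Morse sets are slim.  A first, sublinear, bound comes from comparing the
right angles at `p` and at `z`; applied to the point at distance `dist p w` from `p` on `[p, x]`,
it shows that the angle at `p` is almost `π`, and this yields a uniform bound. -/
theorem slim_of_cornerMorse {N : ℝ} {S : Set X} (hS : GeodConvex S) (hM : CornerMorse N S)
    {x p q : X} (hp : IsNearestPoint S x p) (hq : q ∈ S) :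
    ∃ z, dist x z + dist z q = dist x q ∧ dist z p ≤ 35 * N := by
  obtain ⟨z, hz, hzm⟩ := exists_nearest_between p x q
  refine ⟨z, hz, ?_⟩
  rw [dist_comm]
  obtain ⟨w, hw, hzw⟩ := hM p hp.1 q hq x z hz hzm
  have hN : 0 ≤ N := dist_nonneg.trans hzw
  obtain ⟨k1, k2⟩ := corner_sq_le hS hp hz hzm hw hzw
  have t1 : dist p z ≤ dist p w + N := by linarith [dist_triangle_right p z w]
  have t2 : dist p w ≤ dist p z + N := by linarith [dist_triangle p z w]
  have p1 := dist_nonneg (x := p) (y := z)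
  have p2 := dist_nonneg (x := p) (y := w)
  rcases le_or_gt (dist p w) N with hLN | hLN
  · linarith
  set L := dist p w with hL
  have hL0 : 0 < L := by linarith
  rcases le_or_gt (dist x p) L with hr | hr
  · have : dist p z ^ 2 ≤ N * (2 * dist p z + N) := by nlinarith
    nlinarith
  · -- `y` is the point at distance `L` from `p` on `[p, x]`.
    set r := dist x p with hrdef
    have hr0 : 0 < r := by linarith
    obtain ⟨y, hy, hy'⟩ := exists_point_between p x hL0.le (by rw [dist_comm]; exact hr.le)
    rw [dist_comm p x, ← hrdef] at hy'
    have hpy : IsNearestPoint S y p := by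
      refine ⟨hp.1, fun s hs => ?_⟩
      have := hp.2 s hs
      have := dist_triangle x y s
      rw [dist_comm y p, dist_comm x y] at *
      linarith
    obtain ⟨v, hv, hvm⟩ := exists_nearest_between p y w
    obtain ⟨w', hw', hvw'⟩ := hM p hp.1 w hw y v hv hvm
    obtain ⟨k1', -⟩ := corner_sq_le hS hpy hv hvm hw' hvw'
    have hvL : dist p v ≤ L := hvm w (by simp)
    rw [dist_comm y p, hy] at k1'
    have p3 := dist_nonneg (x := p) (y := v)
    have c1 : L - dist p v ≤ dist y v := by
      have := dist_triangle_right p y v; linarith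
    have c2 : L - dist p v ≤ dist v w := by
      have := dist_triangle p v w; linarith
    have c3 : 2 * (L - dist p v) ≤ dist w y := by rw [dist_comm w y]; linarith
    have st := dist_sq_le (p := w) (q := p) (r := x) (m := y) (t := L / r)
      (by positivity) (by rw [div_le_one hr0]; exact hr.le)
      (by rw [hy, dist_comm p x, ← hrdef]; field_simp)
      (by rw [hy', dist_comm p x, ← hrdef]; field_simp)
    rw [dist_comm w p, ← hL, dist_comm p x, ← hrdef] at st
    have c5 : dist w x ≤ r + N := by
      have := dist_triangle x z w; rw [dist_comm w x]; linarith
    exact (t1.trans (add_le_add_left (corner_algebra hr hLN hN hvL k1' c3 st dist_nonneg c5) N)).trans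
      (by linarith)

end Slim

section Transfer

/-- A pair of mutually quasi-inverse maps.  The lower bounds for the distances between
images follow from these properties. -/
structure IsQIPair {X : Type u} {Y : Type v} [MetricSpace X] [MetricSpace Y] (L E : ℝ)
    (h : X → Y) (k : Y → X) : Prop where
  one_le : 1 ≤ L
  nonneg : 0 ≤ E
  left : ∀ x x', dist (h x) (h x') ≤ L * dist x x' + E
  right : ∀ y y', dist (k y) (k y') ≤ L * dist y y' + E
  left_inv : ∀ x, dist (k (h x)) x ≤ E
  right_inv : ∀ y, dist (h (k y)) y ≤ E

variable {X : Type u} {Y : Type v} [MetricSpace X] [MetricSpace Y]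
  {L E : ℝ} {h : X → Y} {k : Y → X}

theorem IsQIPair.symm (hk : IsQIPair L E h k) : IsQIPair L E k h :=
  ⟨hk.one_le, hk.nonneg, hk.right, hk.left, hk.right_inv, hk.left_inv⟩

theorem IsQIPair.lower (hk : IsQIPair L E h k) (y y' : Y) :
    dist y y' ≤ L * dist (k y) (k y') + 3 * E := by
  have h1 := dist_triangle4 y (h (k y)) (h (k y')) y'
  have h2 := hk.left (k y) (k y')
  have h3 := hk.right_inv y
  have h4 := hk.right_inv y'
  rw [dist_comm] at h3
  linarith

theorem IsQIPair.isQGeodOn (hk : IsQIPair L E h k) {σ : ℝ → Y} {I : Set ℝ}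
    (hσ : ∀ s ∈ I, ∀ t ∈ I, dist (σ s) (σ t) ≤ |s - t| ∧ |s - t| ≤ 3 * dist (σ s) (σ t)) :
    IsQGeodOn (3 * L) (9 * E) (fun t => k (σ t)) I := by
  intro s hs t ht
  obtain ⟨h1, h2⟩ := hσ s hs t ht
  have h3 := hk.right (σ s) (σ t)
  have h4 := hk.lower (σ s) (σ t)
  have hL := hk.one_le
  have hE := hk.nonneg
  have h5 : L * dist (σ s) (σ t) ≤ L * |s - t| := by gcongr
  have h6 := mul_nonneg (by linarith : 0 ≤ L) (abs_nonneg (s - t))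
  constructor
  · linarith
  · linarith

theorem IsQIPair.isQGeodOn_geod (hk : IsQIPair L E h k) {g : ℝ → Y} {I : Set ℝ}
    (hg : IsGeodOn g I) : IsQGeodOn (3 * L) (9 * E) (fun t => k (g t)) I :=
  hk.isQGeodOn fun s hs t ht => by
    rw [hg s hs t ht]; exact ⟨le_rfl, by linarith [abs_nonneg (s - t)]⟩

theorem IsQIPair.infDist_le (hk : IsQIPair L E h k) {S : Set X} {S' : Set Y} [ProperSpace X]
    (hS : IsClosed S) (hne : S.Nonempty) {N₂ N₃ : ℝ}
    (hSS : ∀ x ∈ S, Metric.infDist (h x) S' ≤ N₃) {y : Y}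
    (hy : Metric.infDist (k y) S ≤ N₂) : Metric.infDist y S' ≤ L * N₂ + 2 * E + N₃ := by
  obtain ⟨x, hx⟩ := exists_isNearestPoint hS hne (k y)
  have e1 := hx.dist_eq
  have e2 := hk.left (k y) x
  have e3 := hk.right_inv y
  have e4 := hSS x hx.1
  have e5 := Metric.infDist_le_infDist_add_dist (s := S') (x := y) (y := h x)
  have e6 := dist_triangle_left y (h x) (h (k y))
  have : L * dist (k y) x ≤ L * N₂ := by
    rw [e1]; exact mul_le_mul_of_nonneg_left hy (by linarith [hk.one_le])
  linarith

/-- Contraction is transported by quasi-isometries between CAT(0) spaces. -/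
theorem IsQIPair.contracting_transfer [ProperSpace X] [ProperSpace Y] [CAT0Space Y]
    (hk : IsQIPair L E h k) (D : ℝ≥0) (N₁ N₃ : ℝ) :
    ∃ D' : ℝ≥0, ∀ (S : Set X) (S' : Set Y), ContractingSet D S → IsClosed S' → S'.Nonempty →
      GeodConvex S' → (∀ y ∈ S', Metric.infDist (k y) S ≤ N₁) →
      (∀ x ∈ S, Metric.infDist (h x) S' ≤ N₃) → ContractingSet D' S' := by
  obtain ⟨N₂, hN₂, hm⟩ := morse_segment X D (L := 3 * L) (E := 9 * E) N₁
    (by linarith [hk.one_le]) (by linarith [hk.nonneg])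
  set N := L * N₂ + 2 * E + N₃ with hN
  refine ⟨(6 * (35 * N)).toNNReal, fun S S' hS hc hne hconv h1 h3 => ⟨hc, hne, ?_⟩⟩
  have hcm : CornerMorse N S' := by
    intro p hp q hq x z hz hzm
    obtain ⟨σ, σ0, σ1, σ2, hσ⟩ := exists_corner_path (p := p) (z := z) (q := q) (by
      intro m hm
      refine hzm m (le_antisymm ?_ (dist_triangle _ _ _))
      linarith [dist_triangle x z m])
    have a0 := dist_nonneg (x := p) (y := z)
    have b0 := dist_nonneg (x := z) (y := q)
    have := hm S hS (fun t => k (σ t)) 0 (dist p z + dist z q) (hk.isQGeodOn hσ)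
      (by rw [σ0]; exact h1 p hp) (by rw [σ2]; exact h1 q hq) (dist p z) ⟨a0, by linarith⟩
    rw [σ1] at this
    obtain ⟨w, hw⟩ := exists_isNearestPoint hc hne z
    exact ⟨w, hw.1, by rw [hw.dist_eq]; exact hk.infDist_le hS.closed hS.nonempty h3 this⟩
  exact isContracting_of_slim hc hne (fun x p q hp hq => slim_of_cornerMorse hconv hcm hp hq)
    (Real.le_coe_toNNReal _)

end Transfer

/-! ### Asymptotic rays and bi-infinite geodesics -/

section Asymptotic

variable {X : Type u} [MetricSpace X]

/-- `f` and `g` stay at bounded distance from each other on `[0, ∞)`. -/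
def Asym (f g : ℝ → X) : Prop :=
  ∃ K : ℝ, ∀ t, 0 ≤ t → dist (f t) (g t) ≤ K

theorem Asym.symm {f g : ℝ → X} (h : Asym f g) : Asym g f := by
  obtain ⟨K, hK⟩ := h
  exact ⟨K, fun t ht => by rw [dist_comm]; exact hK t ht⟩

theorem Asym.trans {f g k : ℝ → X} (h : Asym f g) (h' : Asym g k) : Asym f k := by
  obtain ⟨K, hK⟩ := h
  obtain ⟨K', hK'⟩ := h'
  exact ⟨K + K', fun t ht => (dist_triangle _ (g t) _).trans (add_le_add (hK t ht) (hK' t ht))⟩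

section CAT0

variable [CAT0Space X]

/-- Two rays that come close to each other at arbitrarily large times are asymptotic. -/
theorem asym_of_frequently {f g : ℝ → X} (hf : IsGeodOn f (Ici 0)) (hg : IsGeodOn g (Ici 0))
    {K : ℝ} (h : ∀ T, ∃ s, T ≤ s ∧ ∃ t, 0 ≤ t ∧ dist (f s) (g t) ≤ K) : Asym f g := by
  refine ⟨2 * K + dist (f 0) (g 0), fun u hu => ?_⟩
  obtain ⟨s, hs, t, ht, hst⟩ := h u
  have hs0 : 0 ≤ s := hu.trans hs
  have hK : 0 ≤ K := dist_nonneg.trans hst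
  have e1 := hf.dist_eq self_mem_Ici hs0 hs0
  have e2 := hg.dist_eq self_mem_Ici ht ht
  have e3 := hg s hs0 t ht
  have t1 := dist_triangle4 (f 0) (g 0) (g t) (f s)
  have t2 := dist_triangle4 (g 0) (f 0) (f s) (g t)
  rw [dist_comm (g t) (f s)] at t1
  rw [dist_comm (g 0) (f 0)] at t2
  have e4 : |s - t| ≤ K + dist (f 0) (g 0) := abs_le.2 ⟨by linarith, by linarith⟩
  have t3 := dist_triangle_right (f s) (g s) (g t)
  have m := dist_geod_le_max (hf.mono Icc_subset_Ici_self) (hg.mono Icc_subset_Ici_self) hu hs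
  refine m.trans (max_le ?_ ?_) <;> linarith

/-- The distance between asymptotic rays does not increase. -/
theorem Asym.dist_le {f g : ℝ → X} (h : Asym f g) (hf : IsGeodOn f (Ici 0))
    (hg : IsGeodOn g (Ici 0)) {u : ℝ} (hu : 0 ≤ u) : dist (f u) (g u) ≤ dist (f 0) (g 0) := by
  obtain ⟨K, hK⟩ := h
  have hK0 : 0 ≤ K := dist_nonneg.trans (hK 0 le_rfl)
  apply le_of_forall_pos_le_add
  intro e he
  have hT : 0 < u + u * K / e + 1 := by positivity
  set T := u + u * K / e + 1 with hTdef
  have huK : 0 ≤ u * K / e := by positivity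
  have k := dist_geod_le (hf.mono Icc_subset_Ici_self) (hg.mono Icc_subset_Ici_self) hu
    (by linarith : u ≤ T) hT
  rw [sub_zero, sub_zero] at k
  have k1 : (T - u) / T * dist (f 0) (g 0) ≤ dist (f 0) (g 0) :=
    mul_le_of_le_one_left dist_nonneg (by rw [div_le_one hT]; linarith)
  have k2 : u / T * dist (f T) (g T) ≤ e := by
    calc u / T * dist (f T) (g T) ≤ u / T * K := by gcongr; exact hK T hT.le
      _ = u * K / T := by ring
      _ ≤ e := by
        rw [div_le_iff₀ hT]
        have : u * K / e * e = u * K := by field_simp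
        nlinarith
  linarith

theorem Asym.shift {f g : ℝ → X} (h : Asym f g) (hf : IsGeodOn f univ) (hg : IsGeodOn g univ)
    (s t : ℝ) : Asym (fun u => f (s + u)) (fun u => g (t + u)) := by
  obtain ⟨K, hK⟩ := h
  refine asym_of_frequently (K := K) (hf.comp_add s fun _ _ => mem_univ _)
    (hg.comp_add t fun _ _ => mem_univ _) fun T => ⟨max T (max (-s) (t - s)), le_max_left _ _,
      s + max T (max (-s) (t - s)) - t, ?_, ?_⟩
  · linarith [le_max_right T (max (-s) (t - s)), le_max_right (-s) (t - s)]
  · rw [show t + (s + max T (max (-s) (t - s)) - t) = s + max T (max (-s) (t - s)) by ring]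
    apply hK
    linarith [le_max_right T (max (-s) (t - s)), le_max_left (-s) (t - s)]

theorem Asym.dist_shift_le {f g : ℝ → X} (h : Asym f g) (hf : IsGeodOn f univ)
    (hg : IsGeodOn g univ) (s t : ℝ) {u : ℝ} (hu : 0 ≤ u) :
    dist (f (s + u)) (g (t + u)) ≤ dist (f s) (g t) := by
  simpa using (h.shift hf hg s t).dist_le (hf.comp_add s fun _ _ => mem_univ _)
    (hg.comp_add t fun _ _ => mem_univ _) hu

theorem IsGeodOn.geodConvex_image {g : ℝ → X} {I : Set ℝ} (hI : I.OrdConnected)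
    (hg : IsGeodOn g I) : GeodConvex (g '' I) := by
  have key : ∀ s ∈ I, ∀ t ∈ I, s ≤ t → ∀ m, dist (g s) m + dist m (g t) = dist (g s) (g t) →
      m ∈ g '' I := by
    intro s hs t ht hst m hm
    have e := hg.dist_eq hs ht hst
    have p1 := dist_nonneg (x := g s) (y := m)
    have p2 := dist_nonneg (x := m) (y := g t)
    have hr : s + dist (g s) m ∈ I := hI.out hs ht ⟨by linarith, by linarith⟩
    refine ⟨_, hr, (eq_of_between hm ?_ ?_).symm⟩
    · rw [hg.dist_eq hs hr (by linarith)]; ring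
    · rw [hg.dist_eq hr ht (by linarith)]; linarith
  rintro p ⟨s, hs, rfl⟩ q ⟨t, ht, rfl⟩ m hm
  rcases le_total s t with h | h
  · exact key s hs t ht h m hm
  · refine key t ht s hs h m ?_
    rw [dist_comm (g t) m, dist_comm m (g s), dist_comm (g t) (g s), add_comm]
    exact hm

end CAT0

theorem hausdorffEDist_ne_top_iff {A B : Set X} : Metric.hausdorffEDist A B ≠ ⊤ ↔
    ∃ K : ℝ, (∀ a ∈ A, ∃ b ∈ B, dist a b ≤ K) ∧ ∀ b ∈ B, ∃ a ∈ A, dist b a ≤ K := by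
  constructor
  · intro h
    have hlt : Metric.hausdorffEDist A B < ENNReal.ofReal
        ((Metric.hausdorffEDist A B).toReal + 1) := by
      conv_lhs => rw [← ENNReal.ofReal_toReal h]
      exact (ENNReal.ofReal_lt_ofReal_iff (by positivity)).2 (lt_add_one _)
    refine ⟨(Metric.hausdorffEDist A B).toReal + 1, fun a ha => ?_, fun b hb => ?_⟩
    · obtain ⟨b, hb, hab⟩ := Metric.exists_edist_lt_of_hausdorffEDist_lt ha hlt
      exact ⟨b, hb, (by rwa [edist_lt_ofReal] at hab : dist a b < _).le⟩
    · obtain ⟨a, ha, hab⟩ := Metric.exists_edist_lt_of_hausdorffEDist_lt hb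
        (by rwa [Metric.hausdorffEDist_comm])
      exact ⟨a, ha, (by rwa [edist_lt_ofReal] at hab : dist b a < _).le⟩
  · rintro ⟨K, h1, h2⟩
    refine ne_top_of_le_ne_top (ENNReal.ofReal_ne_top (r := K))
      (Metric.hausdorffEDist_le_of_mem_edist (fun a ha => ?_) fun b hb => ?_)
    · obtain ⟨b, hb, h⟩ := h1 a ha
      exact ⟨b, hb, by rw [edist_dist]; exact ENNReal.ofReal_le_ofReal h⟩
    · obtain ⟨b, hb, h⟩ := h2 b hb
      exact ⟨b, hb, by rw [edist_dist]; exact ENNReal.ofReal_le_ofReal h⟩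

/-- A ray as a function of a real parameter; only its values on `[0, ∞)` matter. -/
noncomputable def rayFun (α : GeodesicRay X) (t : ℝ) : X := α.1 t.toNNReal

theorem rayFun_isGeodOn (α : GeodesicRay X) : IsGeodOn (rayFun α) (Ici 0) := by
  intro s hs t ht
  rw [rayFun, rayFun, α.2.dist_eq, NNReal.dist_eq, Real.coe_toNNReal _ hs, Real.coe_toNNReal _ ht]

theorem rayFun_coe (α : GeodesicRay X) (t : ℝ≥0) : rayFun α t = α.1 t := by simp [rayFun]

theorem rayFun_zero (α : GeodesicRay X) : rayFun α 0 = α.1 0 := by simp [rayFun]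

theorem range_eq_rayFun_image (α : GeodesicRay X) : range α.1 = rayFun α '' Ici 0 := by
  ext x
  constructor
  · rintro ⟨t, rfl⟩; exact ⟨t, t.2, rayFun_coe α t⟩
  · rintro ⟨t, -, rfl⟩; exact ⟨_, rfl⟩

/-- The ray given by a geodesic on `[0, ∞)`. -/
noncomputable def mkRay (g : ℝ → X) (hg : IsGeodOn g (Ici 0)) : GeodesicRay X :=
  have h : Isometry fun t : ℝ≥0 => g t :=
    Isometry.of_dist_eq fun s t => by rw [hg s s.2 t t.2, NNReal.dist_eq]
  ⟨⟨fun t => g t, h.continuous⟩, h⟩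

theorem rayFun_forwardRay (γ : GeodesicLine X) {t : ℝ} (ht : 0 ≤ t) :
    rayFun γ.forwardRay t = γ.1 t := by
  show γ.1 (t.toNNReal : ℝ) = _
  rw [Real.coe_toNNReal _ ht]

theorem rayFun_backwardRay (γ : GeodesicLine X) {t : ℝ} (ht : 0 ≤ t) :
    rayFun γ.backwardRay t = γ.1 (-t) := by
  show γ.1 (-(t.toNNReal : ℝ)) = _
  rw [Real.coe_toNNReal _ ht]

theorem forwardRay_asym (γ : GeodesicLine X) : Asym (rayFun γ.forwardRay) γ.1 :=
  ⟨0, fun t ht => by rw [rayFun_forwardRay γ ht, dist_self]⟩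

theorem backwardRay_asym (γ : GeodesicLine X) :
    Asym (rayFun γ.backwardRay) (fun t => γ.1 (-t)) :=
  ⟨0, fun t ht => by rw [rayFun_backwardRay γ ht, dist_self]⟩

theorem line_isGeodOn (γ : GeodesicLine X) (I : Set ℝ) : IsGeodOn γ.1 I :=
  isGeodOn_of_isometry γ.2 I

theorem line_neg_isGeodOn (γ : GeodesicLine X) (I : Set ℝ) : IsGeodOn (fun t => γ.1 (-t)) I := by
  simpa using (line_isGeodOn γ univ).comp_sub 0 (J := I) fun _ _ => mem_univ _

theorem isClosed_range_line (γ : GeodesicLine X) : IsClosed (range γ.1) :=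
  γ.2.isClosedEmbedding.isClosed_range

theorem isClosed_range_ray (α : GeodesicRay X) : IsClosed (range α.1) :=
  α.2.isClosedEmbedding.isClosed_range

theorem contractingSet_line {γ : GeodesicLine X} {D : ℝ≥0} (h : IsContracting D (range γ.1)) :
    ContractingSet D (range γ.1) :=
  ⟨isClosed_range_line γ, range_nonempty _, h⟩

theorem contractingSet_ray {α : GeodesicRay X} {D : ℝ≥0} (h : IsContracting D (range α.1)) :
    ContractingSet D (range α.1) :=
  ⟨isClosed_range_ray α, range_nonempty _, h⟩

/-- The line `t ↦ γ (-t)`. -/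
def revLine (γ : GeodesicLine X) : GeodesicLine X :=
  ⟨fun t => γ.1 (-t), γ.2.comp (IsometryEquiv.neg ℝ).isometry⟩

theorem range_revLine (γ : GeodesicLine X) : range (revLine γ).1 = range γ.1 := by
  ext x
  constructor
  · rintro ⟨t, rfl⟩; exact ⟨-t, rfl⟩
  · rintro ⟨t, rfl⟩; exact ⟨-t, by simp [revLine]⟩

variable [CAT0Space X]

theorem geodConvex_range_line (γ : GeodesicLine X) : GeodConvex (range γ.1) := by
  rw [← image_univ]
  exact (line_isGeodOn γ univ).geodConvex_image ordConnected_univ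

theorem geodConvex_range_ray (α : GeodesicRay X) : GeodConvex (range α.1) := by
  rw [range_eq_rayFun_image]
  exact (rayFun_isGeodOn α).geodConvex_image ordConnected_Ici

theorem endpoint_eq_iff (α β : GeodesicRay X) :
    α.endpoint = β.endpoint ↔ Asym (rayFun α) (rayFun β) := by
  have : α.endpoint = β.endpoint ↔ Metric.hausdorffEDist (range α.1) (range β.1) ≠ ⊤ :=
    Quotient.eq
  rw [this, hausdorffEDist_ne_top_iff]
  constructor
  · rintro ⟨K, h1, -⟩
    refine asym_of_frequently (rayFun_isGeodOn α) (rayFun_isGeodOn β) (K := K) fun T => ?_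
    obtain ⟨_, ⟨t, rfl⟩, h⟩ := h1 (rayFun α (max T 0)) ⟨_, rfl⟩
    exact ⟨max T 0, le_max_left _ _, t, t.2, by rwa [rayFun_coe]⟩
  · rintro ⟨K, hK⟩
    refine ⟨K, ?_, ?_⟩
    · rintro _ ⟨t, rfl⟩
      exact ⟨β.1 t, ⟨t, rfl⟩, by simpa [rayFun_coe] using hK t t.2⟩
    · rintro _ ⟨t, rfl⟩
      exact ⟨α.1 t, ⟨t, rfl⟩, by rw [dist_comm]; simpa [rayFun_coe] using hK t t.2⟩

theorem joins_iff (γ : GeodesicLine X) (α β : GeodesicRay X) :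
    γ.Joins α.endpoint β.endpoint ↔
      Asym (fun t => γ.1 (-t)) (rayFun α) ∧ Asym γ.1 (rayFun β) := by
  rw [GeodesicLine.Joins, endpoint_eq_iff, endpoint_eq_iff]
  exact and_congr ⟨(backwardRay_asym γ).symm.trans, (backwardRay_asym γ).trans⟩
    ⟨(forwardRay_asym γ).symm.trans, (forwardRay_asym γ).trans⟩

theorem revLine_joins {γ : GeodesicLine X} {a c : VisualBoundary X} (h : γ.Joins a c) :
    (revLine γ).Joins c a := by
  obtain ⟨rfl, rfl⟩ := h
  rw [joins_iff]
  refine ⟨?_, (backwardRay_asym γ).symm⟩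
  simpa [revLine] using (forwardRay_asym γ).symm

theorem Joins.asym_back {γ η : GeodesicLine X} {a b c : VisualBoundary X} (h : γ.Joins a c)
    (h' : η.Joins a b) : Asym (fun t => γ.1 (-t)) (fun t => η.1 (-t)) :=
  (backwardRay_asym γ).symm.trans
    (((endpoint_eq_iff _ _).1 (h.1.trans h'.1.symm)).trans (backwardRay_asym η))

theorem Joins.asym_fwd {γ η : GeodesicLine X} {a b c : VisualBoundary X} (h : γ.Joins a c)
    (h' : η.Joins b c) : Asym γ.1 η.1 :=
  (forwardRay_asym γ).symm.trans
    (((endpoint_eq_iff _ _).1 (h.2.trans h'.2.symm)).trans (forwardRay_asym η))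

theorem Joins.asym_fwd_back {γ η : GeodesicLine X} {a b c : VisualBoundary X} (h : γ.Joins a c)
    (h' : η.Joins c b) : Asym γ.1 (fun t => η.1 (-t)) :=
  (forwardRay_asym γ).symm.trans
    (((endpoint_eq_iff _ _).1 (h.2.trans h'.1.symm)).trans (backwardRay_asym η))

/-- Rays from the same point with the same endpoint are equal. -/
theorem ray_eq_of_endpoint_eq {α β : GeodesicRay X} (h0 : α.1 0 = β.1 0)
    (h : α.endpoint = β.endpoint) : α = β := by
  have k := (endpoint_eq_iff α β).1 h
  ext t
  have := k.dist_le (rayFun_isGeodOn α) (rayFun_isGeodOn β) t.2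
  rw [rayFun_zero, rayFun_zero, h0, dist_self] at this
  simpa [rayFun_coe] using dist_le_zero.1 this

end Asymptotic

section Limits

variable {X : Type u} [MetricSpace X] [ProperSpace X]

/-- A weak form of the Arzelà–Ascoli theorem: pointwise limits along an ultrafilter. -/
theorem exists_pointwise_limit (g : ℕ → ℝ → X) (x₀ : X)
    (hb : ∀ t, ∃ R, ∀ᶠ n in atTop, dist (g n t) x₀ ≤ R) :
    ∃ (U : Ultrafilter ℕ) (φ : ℝ → X), (U : Filter ℕ) ≤ atTop ∧
      ∀ t, Tendsto (fun n => g n t) U (𝓝 (φ t)) := by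
  have hU : (hyperfilter ℕ : Filter ℕ) ≤ atTop := Nat.hyperfilter_le_atTop
  have : ∀ t, ∃ y, Tendsto (fun n => g n t) (hyperfilter ℕ) (𝓝 y) := by
    intro t
    obtain ⟨R, hR⟩ := hb t
    obtain ⟨y, -, hy⟩ := (isCompact_closedBall x₀ R).ultrafilter_le_nhds
      ((hyperfilter ℕ).map fun n => g n t) (by
        rw [le_principal_iff]
        exact hU hR)
    exact ⟨y, hy⟩
  choose φ hφ using this
  exact ⟨hyperfilter ℕ, φ, hU, hφ⟩

theorem isGeodOn_of_tendsto {X : Type u} [MetricSpace X] {g : ℕ → ℝ → X} {φ : ℝ → X}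
    {U : Ultrafilter ℕ} {I : Set ℝ}
    (hU : (U : Filter ℕ) ≤ atTop) (h : ∀ t, Tendsto (fun n => g n t) U (𝓝 (φ t)))
    (hg : ∀ s ∈ I, ∀ t ∈ I, ∀ᶠ n in atTop, dist (g n s) (g n t) = |s - t|) :
    IsGeodOn φ I := by
  intro s hs t ht
  exact tendsto_nhds_unique ((h s).dist (h t))
    (tendsto_const_nhds.congr' (EventuallyEq.symm (hU (hg s hs t ht))))

theorem dist_le_of_tendsto {X : Type u} [MetricSpace X] {g : ℕ → ℝ → X} {φ : ℝ → X}
    {U : Ultrafilter ℕ} (hU : (U : Filter ℕ) ≤ atTop) {t : ℝ}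
    (h : Tendsto (fun n => g n t) U (𝓝 (φ t))) {y : X} {K : ℝ}
    (hK : ∀ᶠ n in atTop, dist (g n t) y ≤ K) : dist (φ t) y ≤ K :=
  le_of_tendsto (h.dist tendsto_const_nhds) (hU hK)

/-- A geodesic from `g m` to `f m` passes at bounded distance from the common origin of the
rays `f` and `g`; parametrized from there, it stays close to `g` for a long time. -/
theorem dist_le_of_pass {X : Type u} [MetricSpace X] [CAT0Space X] {σ g : ℝ → X} {a u m C : ℝ} (hg : IsGeodOn g (Ici 0)) (hm : 0 ≤ m)
    (hσ : IsGeodOn σ (Icc a u)) (ha : a ≤ 0) (hu : 0 ≤ u) (h0 : dist (σ 0) (g 0) ≤ C)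
    (hend : σ u = g m) :
    m - C ≤ u ∧ ∀ t, 0 ≤ t → t ≤ m - C → dist (σ t) (g t) ≤ 3 * C := by
  have hC : 0 ≤ C := dist_nonneg.trans h0
  have e1 : dist (σ 0) (σ u) = u - 0 := hσ.dist_eq ⟨ha, hu⟩ ⟨ha.trans hu, le_rfl⟩ hu
  have e2 : dist (g 0) (g m) = m - 0 := hg.dist_eq self_mem_Ici hm hm
  have t1 := dist_triangle_left (g 0) (g m) (σ 0)
  have t2 := dist_triangle (σ 0) (g 0) (g m)
  rw [← hend] at t1 t2
  rw [← hend] at e2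
  have hmu : m - C ≤ u := by linarith
  refine ⟨hmu, fun t ht htm => ?_⟩
  have hs : 0 ≤ m - C := ht.trans htm
  have k := dist_geod_le_max (hσ.mono (Icc_subset_Icc ha hmu)) (hg.mono Icc_subset_Ici_self) ht htm
  refine k.trans (max_le (by linarith) ?_)
  have e3 : dist (σ (m - C)) (σ u) = u - (m - C) :=
    hσ.dist_eq ⟨by linarith, hmu⟩ ⟨by linarith, le_rfl⟩ hmu
  have e4 : dist (g (m - C)) (g m) = m - (m - C) := hg.dist_eq hs hm (by linarith)
  rw [← hend] at e4
  have := dist_triangle_right (σ (m - C)) (g (m - C)) (σ u)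
  linarith

variable [CAT0Space X]

/-- A ray that is not asymptotic to a contracting ray finally leaves its neighborhoods. -/
theorem exists_far_of_not_asym {f g : ℝ → X} (hf : IsGeodOn f (Ici 0)) (hg : IsGeodOn g (Ici 0))
    (hcl : IsClosed (f '' Ici 0)) (h : ¬ Asym g f) (K : ℝ) :
    ∃ T, 0 ≤ T ∧ ∀ t, T ≤ t → K < Metric.infDist (g t) (f '' Ici 0) := by
  by_contra! hcon
  refine h (asym_of_frequently hg hf (K := K) fun T => ?_)
  obtain ⟨t, ht, ht'⟩ := hcon (max T 0) (le_max_right _ _)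
  obtain ⟨p, hp⟩ := exists_isNearestPoint hcl ⟨f 0, 0, self_mem_Ici, rfl⟩ (g t)
  obtain ⟨s, hs, rfl⟩ := hp.1
  exact ⟨t, (le_max_left _ _).trans ht, s, hs, hp.dist_eq.trans_le ht'⟩

/-- Visibility: a contracting ray and another ray from the same point are joined by a bi-infinite
geodesic, unless they are asymptotic. -/
theorem exists_line_joins {α β : GeodesicRay X} (h0 : α.1 0 = β.1 0) {D : ℝ≥0}
    (hα : IsContracting D (range α.1)) (hne : α.endpoint ≠ β.endpoint) :
    ∃ γ : GeodesicLine X, γ.Joins α.endpoint β.endpoint := by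
  have hS := contractingSet_ray hα
  have hnas : ¬ Asym (rayFun β) (rayFun α) := fun h => hne ((endpoint_eq_iff _ _).2 h.symm)
  have hf := rayFun_isGeodOn α
  have hg := rayFun_isGeodOn β
  have h0' : rayFun α 0 = rayFun β 0 := by rw [rayFun_zero, rayFun_zero, h0]
  have hD : (0 : ℝ) ≤ D := D.2
  obtain ⟨T, hT, hfar⟩ := exists_far_of_not_asym hf hg
    (by rw [← range_eq_rayFun_image]; exact isClosed_range_ray α) hnas (2 * D + 1)
  rw [← range_eq_rayFun_image] at hfar
  set f := rayFun α with hfdef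
  set g := rayFun β with hgdef
  set S := range α.1 with hSdef
  set C : ℝ := dist (proj S (g T)) (g 0) + (6 * D + 2) + (8 * D + 4) with hC
  have hC0 : 0 ≤ C := by rw [hC]; positivity
  have step : ∀ n : ℕ, ∃ (σ : ℝ → X) (a u : ℝ), a ≤ 0 ∧ 0 ≤ u ∧ IsGeodOn σ (Icc a u) ∧
      dist (σ 0) (g 0) ≤ C ∧ σ u = g (T + n) ∧ σ a = f (T + n) := by
    intro n
    obtain ⟨ρ, ρ0, ρ1, hρ⟩ := exists_geod (g (T + n)) (f (T + n))
    set ℓ := dist (g (T + n)) (f (T + n)) with hℓ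
    have hℓ0 : 0 ≤ ℓ := dist_nonneg
    obtain ⟨u, hu, hu'⟩ := hS.exists_near_proj hρ ⟨ℓ, ⟨hℓ0, le_rfl⟩, by
      rw [ρ1, Metric.infDist_zero_of_mem (show f (T + n) ∈ S from ⟨_, rfl⟩)]; linarith⟩
    have hn : (0 : ℝ) ≤ n := n.cast_nonneg
    have hp := hS.dist_proj_le_of_far (a := T) (b := T + n) (by linarith)
      (hg.mono fun t ht => hT.trans ht.1) fun t ht => hfar t ht.1
    refine ⟨fun t => ρ (u - t), u - ℓ, u, by linarith [hu.2], hu.1,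
      hρ.comp_sub u fun t ht => ⟨by linarith [ht.2], by linarith [ht.1]⟩, ?_, by simp [ρ0],
      by simp [ρ1]⟩
    simp only [sub_zero]
    rw [ρ0] at hu'
    have := dist_triangle4 (ρ u) (proj S (g (T + n))) (proj S (g T)) (g 0)
    rw [dist_comm (proj S (g (T + n))) (proj S (g T))] at this
    linarith
  choose σ a u ha hu hσ hσ0 hσu hσa using step
  have fwd := fun n : ℕ => dist_le_of_pass hg (by positivity : 0 ≤ T + n) (hσ n) (ha n) (hu n)
    (hσ0 n) (hσu n)
  have hneg : ∀ n, IsGeodOn (fun t => σ n (-t)) (Icc (-u n) (-a n)) := fun n => by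
    have := (hσ n).comp_sub 0 (J := Icc (-u n) (-a n))
      fun t ht => ⟨by linarith [ht.2], by linarith [ht.1]⟩
    simpa only [zero_sub] using this
  have bwd := fun n : ℕ => dist_le_of_pass (σ := fun t => σ n (-t)) (a := -u n) (u := -a n) hf
    (by positivity : 0 ≤ T + n)
    (hneg n)
    (by linarith [hu n]) (by linarith [ha n]) (by simpa [h0'] using hσ0 n) (by simpa using hσa n)
  have hev : ∀ t : ℝ, ∀ᶠ n : ℕ in atTop, t ≤ T + n - C := by
    intro t
    filter_upwards [eventually_ge_atTop ⌈t + C⌉₊] with n hn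
    have := Nat.ceil_le.1 hn
    linarith
  have hmem : ∀ t : ℝ, ∀ᶠ n : ℕ in atTop, t ∈ Icc (a n) (u n) := by
    intro t
    filter_upwards [hev t, hev (-t)] with n h1 h2
    exact ⟨by linarith [(bwd n).1], by linarith [(fwd n).1]⟩
  obtain ⟨U, φ, hU, hφ⟩ := exists_pointwise_limit σ (g 0) (by
    intro t
    refine ⟨|t| + C, ?_⟩
    filter_upwards [hmem t] with n hn
    have e := hσ n t hn 0 ⟨ha n, hu n⟩
    rw [sub_zero] at e
    linarith [dist_triangle (σ n t) (σ n 0) (g 0), hσ0 n])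
  have hgeod : IsGeodOn φ univ := isGeodOn_of_tendsto hU hφ (by
    intro s _ t _
    filter_upwards [hmem s, hmem t] with n h1 h2
    exact hσ n s h1 t h2)
  refine ⟨⟨φ, Isometry.of_dist_eq fun s t => by
    rw [hgeod s (mem_univ _) t (mem_univ _), Real.dist_eq]⟩, (joins_iff _ _ _).2 ⟨?_, ?_⟩⟩
  · refine ⟨3 * C, fun t ht => dist_le_of_tendsto hU (hφ (-t)) ?_⟩
    filter_upwards [hev t] with n hn
    exact (bwd n).2 t ht hn
  · refine ⟨3 * C, fun t ht => dist_le_of_tendsto hU (hφ t) ?_⟩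
    filter_upwards [hev t] with n hn
    exact (fwd n).2 t ht hn

end Limits

/-! ### Ideal triangles and projections of boundary points -/

section Triangle

variable {X : Type u} [MetricSpace X]

/-- `x` is `C`-close to the three lines `γ`, `η`, `ζ`. -/
def NearTriangle (C : ℝ) (γ η ζ : GeodesicLine X) (x : X) : Prop :=
  (∃ s, dist x (γ.1 s) ≤ C) ∧ (∃ s, dist x (η.1 s) ≤ C) ∧ ∃ s, dist x (ζ.1 s) ≤ C

theorem NearTriangle.mono {C C' : ℝ} (h : C ≤ C') {γ η ζ : GeodesicLine X} {x : X}
    (hx : NearTriangle C γ η ζ x) : NearTriangle C' γ η ζ x :=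
  ⟨hx.1.imp fun _ => h.trans', hx.2.1.imp fun _ => h.trans', hx.2.2.imp fun _ => h.trans'⟩

theorem NearTriangle.of_dist_le {C K : ℝ} {γ η ζ : GeodesicLine X} {x y : X}
    (hx : NearTriangle C γ η ζ x) (hxy : dist y x ≤ K) : NearTriangle (K + C) γ η ζ y := by
  have key : ∀ z, dist x z ≤ C → dist y z ≤ K + C := fun z hz =>
    (dist_triangle y x z).trans (add_le_add hxy hz)
  exact ⟨hx.1.imp fun _ => key _, hx.2.1.imp fun _ => key _, hx.2.2.imp fun _ => key _⟩

theorem abs_sub_le_of_near {ψ : ℝ → X} (hψ : IsGeodOn ψ univ) {x y : X} {s t A B : ℝ}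
    (h1 : dist x (ψ s) ≤ A) (h2 : dist y (ψ t) ≤ B) : |s - t| ≤ A + dist x y + B := by
  rw [← hψ s (mem_univ _) t (mem_univ _)]
  have := dist_triangle4 (ψ s) x y (ψ t)
  rw [dist_comm (ψ s) x] at this
  linarith

variable [CAT0Space X]

theorem nearTriangle_aux {C : ℝ} {γ η ζ : GeodesicLine X} {a b c : VisualBoundary X}
    (hγ : γ.Joins a c) (hη : η.Joins a b) (hζ : ζ.Joins c b) {x y : X} {s s' t t' r r' : ℝ}
    (hs : dist x (γ.1 s) ≤ C) (ht : dist x (η.1 t) ≤ C) (hr : dist x (ζ.1 r) ≤ C)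
    (hs' : dist y (γ.1 s') ≤ C) (ht' : dist y (η.1 t') ≤ C) (hr' : dist y (ζ.1 r') ≤ C)
    (hss : s ≤ s') : dist x y ≤ 8 * C := by
  have gγ := line_isGeodOn γ univ
  have gη := line_isGeodOn η univ
  have gζ := line_isGeodOn ζ univ
  set w := s' - s with hw
  have hw0 : 0 ≤ w := by linarith
  have hC : 0 ≤ C := dist_nonneg.trans hs
  -- Near `a` the lines `γ` and `η` converge.
  have k1 := (Joins.asym_back hγ hη).dist_shift_le (line_neg_isGeodOn γ univ)
    (line_neg_isGeodOn η univ) (-s') (-t') hw0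
  simp only [neg_neg] at k1
  rw [show -(-s' + w) = s by rw [hw]; ring, show -(-t' + w) = t' - w by ring] at k1
  have k1' := dist_triangle_left (γ.1 s') (η.1 t') y
  have m1 := abs_sub_le_of_near gη ht
    (show dist (γ.1 s) (η.1 (t' - w)) ≤ 2 * C by linarith)
  have m1' := (abs_le.1 m1).2
  have hLw : dist x y ≤ 2 * C + w := by
    have e := gγ.dist_eq (mem_univ s) (mem_univ s') hss
    have := dist_triangle4 x (γ.1 s) (γ.1 s') y
    rw [dist_comm (γ.1 s') y] at this
    linarith
  suffices hw6 : w ≤ 6 * C by linarith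
  rcases le_or_gt t' t with htt | htt
  · linarith
  -- Near `b` the lines `η` and `ζ` converge.
  have k2 := (Joins.asym_fwd hη hζ).dist_shift_le gη gζ t r (u := t' - t) (by linarith)
  rw [add_sub_cancel] at k2
  have k2' := dist_triangle_left (η.1 t) (ζ.1 r) x
  have m2 := abs_sub_le_of_near gζ hr'
    (show dist (η.1 t') (ζ.1 (r + (t' - t))) ≤ 2 * C by linarith)
  have m2' := (abs_le.1 m2).1
  -- Near `c` the lines `γ` and `ζ` converge.
  have k3 := (Joins.asym_fwd_back hγ hζ).dist_shift_le gγ (line_neg_isGeodOn ζ univ) s (-r) hw0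
  rw [show s + w = s' by rw [hw]; ring, neg_neg, show -(-r + w) = r - w by ring] at k3
  have k3' := dist_triangle_left (γ.1 s) (ζ.1 r) x
  have m3 := abs_sub_le_of_near gζ hr' (show dist (γ.1 s') (ζ.1 (r - w)) ≤ 2 * C by linarith)
  have m3' := (abs_le.1 m3).2
  linarith

/-- Points that are close to the three sides of an ideal triangle are close to each other: moving
from one to the other along the three sides, one goes towards one of the endpoints of each side,
and by convexity the motions along two sides with a common endpoint agree. -/
theorem NearTriangle.dist_le {C : ℝ} {γ η ζ : GeodesicLine X} {a b c : VisualBoundary X}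
    (hγ : γ.Joins a c) (hη : η.Joins a b) (hζ : ζ.Joins c b) {x y : X}
    (hx : NearTriangle C γ η ζ x) (hy : NearTriangle C γ η ζ y) : dist x y ≤ 8 * C := by
  obtain ⟨⟨s, hs⟩, ⟨t, ht⟩, r, hr⟩ := hx
  obtain ⟨⟨s', hs'⟩, ⟨t', ht'⟩, r', hr'⟩ := hy
  rcases le_total s s' with h | h
  · exact nearTriangle_aux hγ hη hζ hs ht hr hs' ht' hr' h
  · rw [dist_comm]
    exact nearTriangle_aux hγ hη hζ hs' ht' hr' hs ht hr h

end Triangle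

section Projection

variable {X : Type u} [MetricSpace X] [ProperSpace X]

theorem exists_isBarycenter {P : Set X} (hne : P.Nonempty) (hb : Bornology.IsBounded P) :
    ∃ c, IsBarycenter P c := by
  obtain ⟨p, hp⟩ := hne
  set A : Set ℝ := {r | ∃ c, P ⊆ Metric.closedBall c r} with hA
  have hAne : A.Nonempty := by
    obtain ⟨r, hr⟩ := (Metric.isBounded_iff_subset_closedBall p).1 hb
    exact ⟨r, p, hr⟩
  have hAbdd : BddBelow A := ⟨0, fun r ⟨c, hc⟩ => dist_nonneg.trans (hc hp)⟩
  have : ∀ n : ℕ, ∃ c, P ⊆ Metric.closedBall c (sInf A + 1 / ((n : ℝ) + 1)) := by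
    intro n
    obtain ⟨r, ⟨c, hc⟩, hr⟩ := Real.lt_sInf_add_pos hAne (ε := 1 / ((n : ℝ) + 1)) (by positivity)
    exact ⟨c, hc.trans (Metric.closedBall_subset_closedBall hr.le)⟩
  choose c hc using this
  obtain ⟨c₀, -, φ, hφ, hlim⟩ := (isCompact_closedBall p (sInf A + 1)).tendsto_subseq
    (x := c) fun n => by
      have h1 := hc n hp
      rw [Metric.mem_closedBall, dist_comm] at h1
      refine h1.trans ?_
      gcongr
      rw [div_le_one (by positivity)]
      linarith [(Nat.cast_nonneg n : (0 : ℝ) ≤ n)]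
  refine ⟨c₀, sInf A, fun x hx => ?_, fun c' r' h => csInf_le hAbdd ⟨c', h⟩⟩
  have l1 : Tendsto (fun n => dist x (c (φ n))) atTop (𝓝 (dist x c₀)) :=
    tendsto_const_nhds.dist hlim
  have l2 : Tendsto (fun n => sInf A + 1 / ((φ n : ℝ) + 1)) atTop (𝓝 (sInf A + 0)) :=
    tendsto_const_nhds.add (tendsto_one_div_add_atTop_nhds_zero_nat.comp hφ.tendsto_atTop)
  rw [add_zero] at l2
  exact le_of_tendsto_of_tendsto' l1 l2 fun n => hc (φ n) hx

theorem _root_.IsBarycenter.dist_le {X : Type u} [MetricSpace X] {P : Set X} {c p : X} {K : ℝ}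
    (h : IsBarycenter P c) (hp : p ∈ P) (hK : ∀ q ∈ P, dist q p ≤ K) : dist c p ≤ K := by
  obtain ⟨r, hr, hmin⟩ := h
  have h1 := hr hp
  rw [Metric.mem_closedBall, dist_comm] at h1
  exact h1.trans (hmin p K fun q hq => hK q hq)

theorem _root_.IsBarycenter.nonempty {X : Type u} [MetricSpace X] {P : Set X} {c : X}
    (h : IsBarycenter P c) : P.Nonempty := by
  obtain ⟨r, hr, hmin⟩ := h
  by_contra hne
  rw [not_nonempty_iff_eq_empty] at hne
  linarith [hmin c (r - 1) (by simp [hne])]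

theorem projectionLimits_revLine {X : Type u} [MetricSpace X] (γ : GeodesicLine X) (b : VisualBoundary X) :
    projectionLimits (revLine γ) b = projectionLimits γ b := by
  simp only [projectionLimits, range_revLine]

variable [CAT0Space X]

/-- A ray that is not asymptotic to an end of a line finally leaves its neighborhoods. -/
theorem exists_far_of_not_asym_line (γ : GeodesicLine X) {g : ℝ → X} (hg : IsGeodOn g (Ici 0))
    (h1 : ¬ Asym g γ.1) (h2 : ¬ Asym g fun t => γ.1 (-t)) (K : ℝ) :
    ∃ T, 0 ≤ T ∧ ∀ t, T ≤ t → K < Metric.infDist (g t) (range γ.1) := by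
  by_contra! hcon
  have key : ∀ T, ∃ t, T ≤ t ∧ ∃ r, dist (g t) (γ.1 r) ≤ K := by
    intro T
    obtain ⟨t, ht, ht'⟩ := hcon (max T 0) (le_max_right _ _)
    obtain ⟨p, hp⟩ := exists_isNearestPoint (isClosed_range_line γ) (range_nonempty _) (g t)
    obtain ⟨r, rfl⟩ := hp.1
    exact ⟨t, (le_max_left _ _).trans ht, r, hp.dist_eq.trans_le ht'⟩
  by_cases hpos : ∀ T, ∃ s, T ≤ s ∧ ∃ t, 0 ≤ t ∧ dist (g s) (γ.1 t) ≤ K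
  · exact h1 (asym_of_frequently hg (line_isGeodOn γ _) hpos)
  · push Not at hpos
    obtain ⟨T₀, hT₀⟩ := hpos
    refine h2 (asym_of_frequently hg (line_neg_isGeodOn γ _) (K := K) fun T => ?_)
    obtain ⟨t, ht, r, hr⟩ := key (max T T₀)
    refine ⟨t, (le_max_left _ _).trans ht, -r, ?_, by rwa [neg_neg]⟩
    by_contra! hr0
    exact absurd hr (not_le.2 (hT₀ t ((le_max_right _ _).trans ht) r (by linarith)))

theorem exists_far_of_endpoint_ne {γ : GeodesicLine X} {a b c : VisualBoundary X}
    (hγ : γ.Joins a c) (hab : a ≠ b) (hcb : c ≠ b) {β : GeodesicRay X} (hβ : β.endpoint = b)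
    (K : ℝ) :
    ∃ T, 0 ≤ T ∧ ∀ t, T ≤ t → K < Metric.infDist (rayFun β t) (range γ.1) := by
  refine exists_far_of_not_asym_line γ (rayFun_isGeodOn β) (fun h => hcb ?_) (fun h => hab ?_) K
  · rw [← hγ.2, ← hβ, endpoint_eq_iff]
    exact (forwardRay_asym γ).trans h.symm
  · rw [← hγ.1, ← hβ, endpoint_eq_iff]
    exact (backwardRay_asym γ).trans h.symm

/-- The projections of `b` to a contracting line `γ` from `a` to `c` are close to every line from
`a` to `b`. -/
theorem exists_near_of_mem_projectionLimits {D : ℝ≥0} {γ η : GeodesicLine X}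
    (hD : IsContracting D (range γ.1)) {a b c : VisualBoundary X} (hγ : γ.Joins a c)
    (hη : η.Joins a b) (hab : a ≠ b) (hcb : c ≠ b) {p : X} (hp : p ∈ projectionLimits γ b) :
    ∃ t, dist p (η.1 t) ≤ 9 * D + 5 := by
  have hS := contractingSet_line hD
  obtain ⟨β, t, q, hβ, ht, hq, hlim⟩ := hp
  obtain ⟨K, hK⟩ : Asym (rayFun β) η.1 :=
    ((endpoint_eq_iff _ _).1 (hβ.trans hη.2.symm)).trans (forwardRay_asym η)
  obtain ⟨T, hT, hfar⟩ := exists_far_of_endpoint_ne hγ hab hcb hβ K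
  obtain ⟨i, hi, hqi⟩ := ((ht.eventually_ge_atTop T.toNNReal).and
    (hlim.eventually (Metric.ball_mem_nhds p one_pos))).exists
  rw [Real.toNNReal_le_iff_le_coe] at hi
  rw [dist_comm] at hqi
  have hfi := hfar _ hi
  have hKi := hK (t i) (t i).2
  rw [rayFun_coe] at hfi hKi
  have hq' := hS.dist_le_of_lt (hKi.trans_lt hfi) (hq i) (hS.proj_spec (η.1 (t i)))
  have hD0 : (0 : ℝ) ≤ D := D.2
  -- Far out towards `a`, the line `η` projects far away from the projection of `η (t i)`.
  have hex : ∃ s, 0 ≤ s ∧ ∃ w ∈ Icc 0 s,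
      Metric.infDist (η.1 (t i - w)) (range γ.1) ≤ 2 * (D : ℝ) + 1 := by
    by_contra! hcon
    obtain ⟨K₂, hK₂⟩ := Joins.asym_back hγ hη
    set o := proj (range γ.1) (η.1 (t i)) with ho
    have bound : ∀ s, 0 ≤ s → s ≤ 2 * K₂ + (6 * D + 2) + dist o (γ.1 0) := by
      intro s hs
      have k := hS.dist_proj_le_of_far (g := fun w => η.1 (t i - w)) (a := 0) (b := t i + s)
        (by positivity) ((line_isGeodOn η univ).comp_sub _ fun _ _ => mem_univ _)
        (hcon (t i + s) (by positivity))
      simp only [sub_zero] at k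
      rw [show (t i : ℝ) - (t i + s) = -s by ring] at k
      have e1 := hK₂ s hs
      have e2 := hS.dist_proj (η.1 (-s))
      have e3 : Metric.infDist (η.1 (-s)) (range γ.1) ≤ dist (η.1 (-s)) (γ.1 (-s)) :=
        Metric.infDist_le_dist_of_mem ⟨_, rfl⟩
      have e4 : dist (γ.1 (-s)) (γ.1 0) = 0 - -s :=
        (line_isGeodOn γ univ).dist_eq (mem_univ _) (mem_univ _) (by linarith)
      have e5 := dist_triangle4 (γ.1 (-s)) (η.1 (-s)) (proj (range γ.1) (η.1 (-s))) (γ.1 0)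
      have e6 := dist_triangle_left (proj (range γ.1) (η.1 (-s))) (γ.1 0) o
      rw [dist_comm (η.1 (-s)) (γ.1 (-s))] at e3
      linarith
    have hK0 : 0 ≤ K₂ := dist_nonneg.trans (hK₂ 0 le_rfl)
    have := bound (2 * K₂ + (6 * D + 2) + dist o (γ.1 0) + 1) (by positivity)
    linarith
  obtain ⟨s, hs, hw⟩ := hex
  obtain ⟨u, -, hu⟩ := hS.exists_near_proj (g := fun w => η.1 (t i - w)) (a := 0) (b := s)
    ((line_isGeodOn η univ).comp_sub _ fun _ _ => mem_univ _) hw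
  simp only [sub_zero] at hu
  refine ⟨t i - u, ?_⟩
  have := dist_triangle4 p (q i) (proj (range γ.1) (η.1 (t i))) (η.1 (t i - u))
  rw [dist_comm] at hu
  linarith

theorem projectionLimits_nonempty {D : ℝ≥0} {γ : GeodesicLine X}
    (hD : IsContracting D (range γ.1)) {a b c : VisualBoundary X} (hγ : γ.Joins a c)
    (hab : a ≠ b) (hcb : c ≠ b) : (projectionLimits γ b).Nonempty := by
  have hS := contractingSet_line hD
  obtain ⟨β, hβ⟩ := Quotient.exists_rep b
  obtain ⟨T, hT, hfar⟩ := exists_far_of_endpoint_ne hγ hab hcb hβ (2 * D + 1)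
  obtain ⟨p, -, φ, hφ, hlim⟩ := (isCompact_closedBall (proj (range γ.1) (rayFun β T))
    (6 * D + 2)).tendsto_subseq (x := fun n : ℕ => proj (range γ.1) (rayFun β (T + n))) fun n => by
      rw [Metric.mem_closedBall, dist_comm]
      exact hS.dist_proj_le_of_far (a := T) (b := T + n)
        (by linarith [(Nat.cast_nonneg n : (0 : ℝ) ≤ n)])
        ((rayFun_isGeodOn β).mono fun t ht => hT.trans ht.1) fun t ht => hfar t ht.1
  refine ⟨p, β, fun n => (T + φ n).toNNReal, _, hβ, ?_, fun n => hS.proj_spec _, hlim⟩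
  refine tendsto_real_toNNReal_atTop.comp (tendsto_atTop_add_const_left _ _ ?_)
  exact tendsto_natCast_atTop_atTop.comp hφ.tendsto_atTop

theorem nearTriangle_of_mem_projectionLimits {D : ℝ≥0} {γ η ζ : GeodesicLine X}
    (hD : IsContracting D (range γ.1)) {a b c : VisualBoundary X} (hγ : γ.Joins a c)
    (hη : η.Joins a b) (hζ : ζ.Joins c b) (hab : a ≠ b) (hcb : c ≠ b) {p : X}
    (hp : p ∈ projectionLimits γ b) : NearTriangle (9 * D + 5) γ η ζ p := by
  refine ⟨?_, exists_near_of_mem_projectionLimits hD hγ hη hab hcb hp,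
    exists_near_of_mem_projectionLimits (γ := revLine γ) (by rwa [range_revLine])
      (revLine_joins hγ) hζ hcb hab (by rwa [projectionLimits_revLine])⟩
  obtain ⟨β, t, q, -, -, hq, hlim⟩ := hp
  obtain ⟨s, hs⟩ := (isClosed_range_line γ).mem_of_tendsto hlim (.of_forall fun i => (hq i).1)
  exact ⟨s, by rw [hs, dist_self]; positivity⟩

theorem exists_isBoundaryProjection {D : ℝ≥0} {γ η ζ : GeodesicLine X}
    (hD : IsContracting D (range γ.1)) {a b c : VisualBoundary X} (hγ : γ.Joins a c)
    (hη : η.Joins a b) (hζ : ζ.Joins c b) (hab : a ≠ b) (hcb : c ≠ b) :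
    ∃ m, IsBoundaryProjection γ b m := by
  refine exists_isBarycenter (projectionLimits_nonempty hD hγ hab hcb) ?_
  rw [Metric.isBounded_iff]
  exact ⟨_, fun x hx y hy => NearTriangle.dist_le hγ hη hζ
    (nearTriangle_of_mem_projectionLimits hD hγ hη hζ hab hcb hx)
    (nearTriangle_of_mem_projectionLimits hD hγ hη hζ hab hcb hy)⟩

theorem nearTriangle_of_isBoundaryProjection {D : ℝ≥0} {γ η ζ : GeodesicLine X}
    (hD : IsContracting D (range γ.1)) {a b c : VisualBoundary X} (hγ : γ.Joins a c)
    (hη : η.Joins a b) (hζ : ζ.Joins c b) (hab : a ≠ b) (hcb : c ≠ b) {m : X}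
    (hm : IsBoundaryProjection γ b m) : NearTriangle (9 * (9 * D + 5)) γ η ζ m := by
  have key := fun x (hx : x ∈ projectionLimits γ b) =>
    nearTriangle_of_mem_projectionLimits hD hγ hη hζ hab hcb hx
  obtain ⟨p, hp⟩ := IsBarycenter.nonempty hm
  have := IsBarycenter.dist_le hm hp fun q hq =>
    NearTriangle.dist_le hγ hη hζ (key q hq) (key p hp)
  exact ((key p hp).of_dist_le this).mono (by linarith)

end Projection

/-! ### Images of contracting rays and lines under quasi-isometries -/

section Images

variable {X : Type u} {Y : Type v} [MetricSpace X] [MetricSpace Y]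
  {L E : ℝ} {h : X → Y} {k : Y → X}

theorem exists_crossing {τ : ℕ → ℝ} {t : ℝ} {m : ℕ} (h0 : τ 0 ≤ t) (hm : t < τ m) :
    ∃ i, τ i ≤ t ∧ t < τ (i + 1) := by
  by_contra! hcon
  have : ∀ i, τ i ≤ t := fun i => by
    induction i with
    | zero => exact h0
    | succ i ih => exact hcon i ih
  exact absurd hm (not_lt.2 (this m))

/-- A chain of points that stays close to a geodesic `f` passes near all points of `f` that it
overtakes. -/
theorem exists_near_of_crossing {f : ℝ → X} {I : Set ℝ} (hf : IsGeodOn f I) {c : ℕ → X}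
    {τ : ℕ → ℝ} (hτ : ∀ i, τ i ∈ I) {N A t : ℝ} {m : ℕ} (hc : ∀ i, dist (c i) (f (τ i)) ≤ N)
    (hA : ∀ i, dist (c i) (c (i + 1)) ≤ A) (ht : t ∈ I) (h0 : τ 0 ≤ t) (hm : t < τ m) :
    ∃ i, dist (f t) (c i) ≤ 3 * N + A := by
  obtain ⟨i, h1, h2⟩ := exists_crossing h0 hm
  refine ⟨i, ?_⟩
  have e1 := hf.dist_eq (hτ i) ht h1
  have e2 := hf.dist_eq (hτ i) (hτ (i + 1)) (h1.trans h2.le)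
  have t1 := dist_triangle4 (f (τ i)) (c i) (c (i + 1)) (f (τ (i + 1)))
  have t2 := dist_triangle_right (f t) (c i) (f (τ i))
  rw [dist_comm (f (τ i)) (c i)] at t1
  rw [dist_comm (f t) (f (τ i))] at t2
  linarith [hc i, hc (i + 1), hA i]

theorem IsQIPair.dist_le_of_inv_near (hk : IsQIPair L E h k) {x : X} {y : Y} {N : ℝ}
    (hN : dist x (k y) ≤ N) : dist (h x) y ≤ L * N + 2 * E := by
  have e1 := hk.left x (k y)
  have e2 := dist_triangle (h x) (h (k y)) y
  have e3 := hk.right_inv y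
  have : L * dist x (k y) ≤ L * N := mul_le_mul_of_nonneg_left hN (by linarith [hk.one_le])
  linarith [hk.nonneg]

theorem IsQIPair.exists_param_gt (hk : IsQIPair L E h k) {f : ℝ → X} {g : ℝ → Y}
    (hf : IsGeodOn f univ) (hg : IsGeodOn g univ) {τ : ℝ → ℝ} {N : ℝ}
    (hτ : ∀ t, dist (k (g t)) (f (τ t)) ≤ N)
    (hfwd : ∃ K, ∀ t, 0 ≤ t → ∃ s, 0 ≤ s ∧ dist (k (g t)) (f s) ≤ K) (t₀ : ℝ) :
    ∃ n : ℕ, t₀ < τ n := by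
  obtain ⟨K, hK⟩ := hfwd
  have hL := hk.one_le
  set B := |t₀| + N + K + 2 * N + |τ 0| + 1 with hB
  obtain ⟨n, hn⟩ := exists_nat_gt (L * B + 3 * E)
  refine ⟨n, ?_⟩
  obtain ⟨s, hs, hs'⟩ := hK n n.cast_nonneg
  have e1 := dist_triangle_left (f (τ n)) (f s) (k (g n))
  rw [hf _ (mem_univ _) _ (mem_univ _)] at e1
  have e1' := (abs_le.1 (e1.trans (add_le_add (hτ n) hs'))).1
  have e2 := hk.lower (g 0) (g n)
  have e3 : dist (g 0) (g n) = n - 0 := hg.dist_eq (mem_univ _) (mem_univ _) n.cast_nonneg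
  have e4 := dist_triangle4 (k (g 0)) (f (τ 0)) (f (τ n)) (k (g n))
  rw [hf _ (mem_univ _) _ (mem_univ _), dist_comm (f (τ n)) (k (g n))] at e4
  have e5 : L * B < L * (2 * N + |τ 0 - τ n|) := by
    have : L * dist (k (g 0)) (k (g n)) ≤ L * (2 * N + |τ 0 - τ n|) :=
      mul_le_mul_of_nonneg_left (by linarith [hτ 0, hτ n]) (by linarith)
    linarith
  have e6 := lt_of_mul_lt_mul_left e5 (by linarith)
  have e7 := abs_sub (τ 0) (τ n)
  have hK0 : 0 ≤ K := dist_nonneg.trans hs'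
  have hN0 : 0 ≤ N := dist_nonneg.trans (hτ 0)
  have e8 : |t₀| + N + K < |τ n| := by linarith
  have e9 := le_abs_self t₀
  rcases le_total 0 (τ n) with h0 | h0
  · rw [abs_of_nonneg h0] at e8; linarith
  · rw [abs_of_nonpos h0] at e8; linarith [abs_nonneg t₀]

variable [ProperSpace X] [ProperSpace Y] [CAT0Space Y]

/-- A contracting ray `α` from `x₀` is mapped by `h` into a bounded neighborhood of a
contracting ray `β` from `y₀`, with bounds that depend only on the contraction constant of `α`.
The ray `β` is a limit of geodesics from `y₀` to the points `h (α n)`. -/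
theorem IsQIPair.exists_ray (hk : IsQIPair L E h k) (x₀ : X) (y₀ : Y) (D : ℝ≥0) :
    ∃ (N : ℝ) (D' : ℝ≥0), ∀ α : GeodesicRay X, α.1 0 = x₀ → IsContracting D (range α.1) →
      ∃ β : GeodesicRay Y, β.1 0 = y₀ ∧ IsContracting D' (range β.1) ∧
        (∀ y ∈ range β.1, Metric.infDist (k y) (range α.1) ≤ N) ∧
        ∀ x ∈ range α.1, Metric.infDist (h x) (range β.1) ≤ N := by
  have hL := hk.one_le
  have hE := hk.nonneg
  set R := max (dist (k y₀) x₀) E with hR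
  obtain ⟨N₁, hN₁, hm⟩ := morse_segment X D (L := 3 * L) (E := 9 * E) R
    (by linarith) (by linarith)
  set N₂ := N₁ + (L + E) with hN₂
  set N₃ := R + 3 * N₂ + (L + E) with hN₃
  have hR0 : 0 ≤ R := hE.trans (le_max_right _ _)
  set N := N₂ + (L * N₃ + 2 * E) with hN
  have hN₃0 : 0 ≤ L * N₃ := mul_nonneg (by linarith) (by linarith)
  obtain ⟨D', hD'⟩ := hk.contracting_transfer D N N
  refine ⟨N, D', fun α hα0 hα => ?_⟩
  have hS := contractingSet_ray hα
  have hgα := rayFun_isGeodOn α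
  have hα0' : rayFun α 0 = x₀ := by rw [rayFun_zero, hα0]
  -- `g n` is the geodesic from `y₀` to `h (α n)`, of length `ℓ n`.
  choose g g0 g1 hg using fun n : ℕ => exists_geod y₀ (h (rayFun α n))
  set ℓ : ℕ → ℝ := fun n => dist y₀ (h (rayFun α n)) with hℓ
  have hℓn : ∀ n : ℕ, (n : ℝ) ≤ L * (ℓ n + dist y₀ (h x₀)) + 3 * E := by
    intro n
    have e1 := hk.symm.lower x₀ (rayFun α n)
    have e2 : dist (rayFun α 0) (rayFun α n) = n - 0 :=
      hgα.dist_eq self_mem_Ici (mem_Ici.2 n.cast_nonneg) n.cast_nonneg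
    rw [hα0'] at e2
    have e3 := dist_triangle_left (h x₀) (h (rayFun α n)) y₀
    have e4 := mul_le_mul_of_nonneg_left e3 (by linarith : 0 ≤ L)
    simp only [hℓ]
    linarith
  have hev : ∀ t : ℝ, ∀ᶠ n : ℕ in atTop, t ≤ ℓ n := by
    intro t
    filter_upwards [eventually_ge_atTop ⌈L * (t + dist y₀ (h x₀)) + 3 * E⌉₊] with n hn
    have h1 := Nat.ceil_le.1 hn
    have h2 : L * (t + dist y₀ (h x₀)) ≤ L * (ℓ n + dist y₀ (h x₀)) := by linarith [hℓn n]
    linarith [le_of_mul_le_mul_left h2 (by linarith)]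
  have hnear : ∀ n, ∀ t ∈ Icc 0 (ℓ n), Metric.infDist (k (g n t)) (range α.1) ≤ N₁ := by
    intro n
    refine hm _ hS (fun t => k (g n t)) 0 (ℓ n) (hk.isQGeodOn_geod (hg n)) ?_ ?_
    · rw [g0]
      exact (Metric.infDist_le_dist_of_mem (show x₀ ∈ range α.1 from ⟨0, hα0⟩)).trans (le_max_left _ _)
    · simp only [hℓ]
      rw [g1]
      exact (Metric.infDist_le_dist_of_mem (show rayFun α n ∈ range α.1 from ⟨_, rfl⟩)).trans
        ((hk.left_inv _).trans (le_max_right _ _))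
  obtain ⟨U, φ, hU, hφ⟩ := exists_pointwise_limit (fun n t => g n |t|) y₀ (by
    intro t
    refine ⟨|t|, ?_⟩
    filter_upwards [hev |t|] with n hn
    have : dist (g n 0) (g n |t|) = |t| - 0 :=
      (hg n).dist_eq ⟨le_rfl, (abs_nonneg t).trans hn⟩ ⟨abs_nonneg t, hn⟩ (abs_nonneg t)
    rw [dist_comm, ← g0 n, this, sub_zero])
  have hgeod : IsGeodOn φ (Ici 0) := isGeodOn_of_tendsto hU hφ (by
    intro s hs t ht
    filter_upwards [hev s, hev t] with n h1 h2
    rw [abs_of_nonneg hs, abs_of_nonneg ht]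
    exact hg n s ⟨hs, h1⟩ t ⟨ht, h2⟩)
  have hφ0 : φ 0 = y₀ := dist_le_zero.1 (dist_le_of_tendsto (g := fun n t => g n |t|) hU (hφ 0)
    (.of_forall fun n => by simp [g0]))
  have hφnear : ∀ t, 0 ≤ t → Metric.infDist (k (φ t)) (range α.1) ≤ N₂ := by
    intro t ht
    obtain ⟨n, h1, h2⟩ := ((hev t).filter_mono hU |>.and
      ((hφ t).eventually (Metric.ball_mem_nhds (φ t) one_pos))).exists
    rw [abs_of_nonneg ht] at h2
    have e1 := Metric.infDist_le_infDist_add_dist (s := range α.1) (x := k (φ t)) (y := k (g n t))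
    have e2 := hk.right (φ t) (g n t)
    have e3 : dist (g n t) (φ t) < 1 := h2
    rw [dist_comm] at e3
    have e4 := mul_le_mul_of_nonneg_left e3.le (by linarith : 0 ≤ L)
    linarith [hnear n t ⟨ht, h1⟩]
  set β := mkRay φ hgeod with hβ
  have hβφ : ∀ t : ℝ≥0, β.1 t = φ t := fun t => rfl
  have near₁ : ∀ y ∈ range β.1, Metric.infDist (k y) (range α.1) ≤ N := by
    rintro _ ⟨t, rfl⟩
    rw [hβφ]
    linarith [hφnear t t.2]
  -- The projections of the points `k (φ i)` to `α` go to infinity with bounded steps.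
  have near₂ : ∀ x ∈ range α.1, Metric.infDist (h x) (range β.1) ≤ N := by
    rintro _ ⟨t, rfl⟩
    have hτ : ∀ i : ℕ, ∃ τ : ℝ, 0 ≤ τ ∧ dist (k (φ i)) (rayFun α τ) ≤ N₂ := by
      intro i
      obtain ⟨p, hp⟩ := exists_isNearestPoint hS.closed hS.nonempty (k (φ i))
      obtain ⟨s, rfl⟩ := hp.1
      exact ⟨s, s.2, by rw [rayFun_coe, hp.dist_eq]; exact hφnear i i.cast_nonneg⟩
    choose τ τ0 hτ using hτ
    have hstart : dist x₀ (k y₀) ≤ R := by rw [dist_comm]; exact le_max_left _ _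
    have hτeq : ∀ i, dist x₀ (rayFun α (τ i)) = τ i := fun i => by
      rw [← hα0', hgα.dist_eq self_mem_Ici (τ0 i) (τ0 i), sub_zero]
    obtain ⟨i, hi⟩ : ∃ i : ℕ, dist (rayFun α t) (k (φ i)) ≤ N₃ := by
      rcases le_or_gt (τ 0) t with h1 | h1
      · obtain ⟨m, hm⟩ := exists_nat_gt (L * (t + R + N₂) + 3 * E)
        have hτm : (t : ℝ) < τ m := by
          have e1 := hk.lower (φ 0) (φ m)
          have e2 : dist (φ 0) (φ m) = m - 0 :=
            hgeod.dist_eq self_mem_Ici (mem_Ici.2 m.cast_nonneg) m.cast_nonneg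
          have e3 := dist_triangle4 (k (φ 0)) x₀ (rayFun α (τ m)) (k (φ m))
          rw [hτeq, hφ0, dist_comm (k y₀) x₀, dist_comm (rayFun α (τ m)) (k (φ m))] at e3
          have e4 : dist (k y₀) (k (φ m)) ≤ τ m + R + N₂ := by linarith [hτ m]
          rw [hφ0] at e1 e2
          have e5 := mul_le_mul_of_nonneg_left e4 (by linarith : 0 ≤ L)
          have e6 : L * (t + R + N₂) < L * (τ m + R + N₂) := by linarith
          linarith [lt_of_mul_lt_mul_left e6 (by linarith)]
        obtain ⟨i, hi⟩ := exists_near_of_crossing (c := fun i : ℕ => k (φ i)) (A := L + E) hgα τ0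
          hτ (fun i => by
            have e1 := hk.right (φ i) (φ (i + 1 : ℕ))
            have e2 : dist (φ i) (φ (i + 1 : ℕ)) = (i + 1 : ℕ) - i :=
              hgeod.dist_eq (mem_Ici.2 i.cast_nonneg)
                (mem_Ici.2 (i + 1).cast_nonneg) (by push_cast; linarith)
            rw [e2] at e1
            push_cast at e1 ⊢
            linarith) (mem_Ici.2 t.coe_nonneg) h1 hτm
        exact ⟨i, by linarith⟩
      · refine ⟨0, ?_⟩
        have e1 := hgα.dist_eq (mem_Ici.2 t.coe_nonneg) (τ0 0) h1.le
        have e2 := dist_triangle_right (rayFun α t) (k (φ (0 : ℕ))) (rayFun α (τ 0))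
        have e3 := dist_triangle4 x₀ (k y₀) (k (φ (0 : ℕ))) (rayFun α (τ 0))
        have e4 := hτ 0
        rw [hτeq] at e3
        simp only [Nat.cast_zero, hφ0, dist_self] at *
        have : (0 : ℝ) ≤ t := t.coe_nonneg
        linarith
    rw [← rayFun_coe]
    have k1 := hk.dist_le_of_inv_near hi
    have k2 : Metric.infDist (h (rayFun α t)) (range β.1) ≤ dist (h (rayFun α t)) (φ i) :=
      Metric.infDist_le_dist_of_mem ⟨(i : ℝ≥0), by rw [hβφ]; simp⟩
    linarith
  exact ⟨β, by rw [hβφ]; exact hφ0, (hD' _ _ hS (isClosed_range_ray β) (range_nonempty _)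
    (geodConvex_range_ray β) near₁ near₂).contracting, near₁, near₂⟩

/-- The image of a contracting line is uniformly close to a contracting line, provided that it is
close to this line at all, with the right ends. -/
theorem IsQIPair.line_near (hk : IsQIPair L E h k) (D : ℝ≥0) :
    ∃ (N : ℝ) (D' : ℝ≥0), ∀ (γ : GeodesicLine X) (γ' : GeodesicLine Y),
      IsContracting D (range γ.1) →
      (∃ K, ∀ t, 0 ≤ t → ∃ s, 0 ≤ s ∧ dist (k (γ'.1 t)) (γ.1 s) ≤ K) →
      (∃ K, ∀ t, 0 ≤ t → ∃ s, 0 ≤ s ∧ dist (k (γ'.1 (-t))) (γ.1 (-s)) ≤ K) →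
      IsContracting D' (range γ'.1) ∧
        ∀ x ∈ range γ.1, Metric.infDist (h x) (range γ'.1) ≤ N := by
  have hL := hk.one_le
  have hE := hk.nonneg
  obtain ⟨N₁, hN₁, hm⟩ := morse_line X D (L := 3 * L) (E := 9 * E) (by linarith) (by linarith)
  set N := L * (3 * N₁ + (L + E)) + 2 * E with hN
  obtain ⟨D', hD'⟩ := hk.contracting_transfer D N₁ N
  refine ⟨N, D', fun γ γ' hγ hfwd hbwd => ?_⟩
  have hS := contractingSet_line hγ
  have gγ := line_isGeodOn γ univ
  have gγ' := line_isGeodOn γ' univ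
  have near₁ : ∀ t, Metric.infDist (k (γ'.1 t)) (range γ.1) ≤ N₁ := by
    obtain ⟨K, hK⟩ := hfwd
    obtain ⟨K', hK'⟩ := hbwd
    refine hm _ hS (fun t => k (γ'.1 t)) (max K K') (hk.isQGeodOn_geod gγ') fun t => ?_
    rcases le_total 0 t with ht | ht
    · obtain ⟨s, -, hs⟩ := hK t ht
      exact (Metric.infDist_le_dist_of_mem (mem_range_self _)).trans (hs.trans (le_max_left _ _))
    · obtain ⟨s, -, hs⟩ := hK' (-t) (by linarith)
      rw [neg_neg] at hs
      exact (Metric.infDist_le_dist_of_mem (mem_range_self _)).trans (hs.trans (le_max_right _ _))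
  have hτ : ∀ t, ∃ τ, dist (k (γ'.1 t)) (γ.1 τ) ≤ N₁ := by
    intro t
    obtain ⟨p, hp⟩ := exists_isNearestPoint hS.closed hS.nonempty (k (γ'.1 t))
    obtain ⟨s, rfl⟩ := hp.1
    exact ⟨s, hp.dist_eq.trans_le (near₁ t)⟩
  choose τ hτ using hτ
  have near₂ : ∀ x ∈ range γ.1, Metric.infDist (h x) (range γ'.1) ≤ N := by
    rintro _ ⟨t, rfl⟩
    obtain ⟨m, hm⟩ := hk.exists_param_gt gγ gγ' hτ hfwd t
    obtain ⟨n, hn⟩ := hk.exists_param_gt (τ := fun t => -τ (-t)) (line_neg_isGeodOn γ univ)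
      (line_neg_isGeodOn γ' univ) (fun t => by simpa using hτ (-t)) hbwd (-t)
    obtain ⟨i, hi⟩ := exists_near_of_crossing (c := fun i : ℕ => k (γ'.1 (-n + i)))
      (τ := fun i : ℕ => τ (-n + i)) (m := n + m) gγ (fun _ => mem_univ _) (A := L + E)
      (fun i => hτ _) (fun i => by
        have e1 := hk.right (γ'.1 (-n + i)) (γ'.1 (-n + (i + 1 : ℕ)))
        have e2 : dist (γ'.1 (-n + i)) (γ'.1 (-n + (i + 1 : ℕ))) = (-n + (i + 1 : ℕ)) - (-n + i) :=
          gγ'.dist_eq (mem_univ _) (mem_univ _) (by push_cast; linarith)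
        rw [e2] at e1
        push_cast at e1 ⊢
        linarith) (mem_univ t) (by simp only [Nat.cast_zero, add_zero]; linarith)
      (by push_cast; rw [show -(n : ℝ) + (n + m) = m by ring]; exact hm)
    exact (Metric.infDist_le_dist_of_mem (mem_range_self _)).trans (hk.dist_le_of_inv_near hi)
  exact ⟨(hD' _ _ hS (isClosed_range_line γ') (range_nonempty _) (geodConvex_range_line γ')
    (by rintro _ ⟨t, rfl⟩; exact near₁ t) near₂).contracting, near₂⟩

end Images

/-! ### The induced map of Morse boundaries -/

section Induced

variable {X : Type u} {Y : Type v} [MetricSpace X] [MetricSpace Y]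
  {L E : ℝ} {h : X → Y} {k : Y → X} {x₀ : X} {y₀ : Y}

theorem hausdorffEDist_trans {A B C : Set X} (h : Metric.hausdorffEDist A B ≠ ⊤)
    (h' : Metric.hausdorffEDist B C ≠ ⊤) : Metric.hausdorffEDist A C ≠ ⊤ :=
  ne_top_of_le_ne_top (ENNReal.add_ne_top.2 ⟨h, h'⟩) Metric.hausdorffEDist_triangle

theorem hausdorffEDist_symm {A B : Set X} (h : Metric.hausdorffEDist A B ≠ ⊤) :
    Metric.hausdorffEDist B A ≠ ⊤ := by rwa [Metric.hausdorffEDist_comm]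

theorem endpoint_eq_iff_hausdorffEDist (α β : GeodesicRay X) :
    α.endpoint = β.endpoint ↔ Metric.hausdorffEDist (range α.1) (range β.1) ≠ ⊤ :=
  Quotient.eq

theorem IsQIPair.hausdorffEDist_image (hk : IsQIPair L E h k) {A B : Set X}
    (hAB : Metric.hausdorffEDist A B ≠ ⊤) : Metric.hausdorffEDist (h '' A) (h '' B) ≠ ⊤ := by
  obtain ⟨K, h1, h2⟩ := hausdorffEDist_ne_top_iff.1 hAB
  have key : ∀ a b, dist a b ≤ K → dist (h a) (h b) ≤ L * K + E := fun a b hab => by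
    have := mul_le_mul_of_nonneg_left hab (by linarith [hk.one_le] : 0 ≤ L)
    linarith [hk.left a b]
  refine hausdorffEDist_ne_top_iff.2 ⟨L * K + E, ?_, ?_⟩
  · rintro _ ⟨a, ha, rfl⟩
    obtain ⟨b, hb, hab⟩ := h1 a ha
    exact ⟨h b, ⟨b, hb, rfl⟩, key a b hab⟩
  · rintro _ ⟨b, hb, rfl⟩
    obtain ⟨a, ha, hab⟩ := h2 b hb
    exact ⟨h a, ⟨a, ha, rfl⟩, key b a hab⟩

theorem IsQIPair.hausdorffEDist_image_image (hk : IsQIPair L E h k) (A : Set X) :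
    Metric.hausdorffEDist A (k '' (h '' A)) ≠ ⊤ := by
  refine hausdorffEDist_ne_top_iff.2 ⟨E, fun a ha => ⟨k (h a), ⟨_, ⟨a, ha, rfl⟩, rfl⟩, ?_⟩, ?_⟩
  · rw [dist_comm]; exact hk.left_inv a
  · rintro _ ⟨_, ⟨a, ha, rfl⟩, rfl⟩
    exact ⟨a, ha, hk.left_inv a⟩

theorem IsQIPair.hausdorffEDist_image_of_infDist [ProperSpace X] [ProperSpace Y]
    (hk : IsQIPair L E h k) {S : Set X} {S' : Set Y} (hS : IsClosed S) (hS' : IsClosed S')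
    (hne : S.Nonempty) (hne' : S'.Nonempty) {N : ℝ} (h1 : ∀ y ∈ S', Metric.infDist (k y) S ≤ N)
    (h2 : ∀ x ∈ S, Metric.infDist (h x) S' ≤ N) :
    Metric.hausdorffEDist (h '' S) S' ≠ ⊤ := by
  refine hausdorffEDist_ne_top_iff.2 ⟨max N (L * N + 2 * E), ?_, fun y hy => ?_⟩
  · rintro _ ⟨x, hx, rfl⟩
    obtain ⟨p, hp⟩ := exists_isNearestPoint hS' hne' (h x)
    exact ⟨p, hp.1, hp.dist_eq.trans_le ((h2 x hx).trans (le_max_left _ _))⟩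
  · obtain ⟨p, hp⟩ := exists_isNearestPoint hS hne (k y)
    refine ⟨h p, ⟨p, hp.1, rfl⟩, ?_⟩
    rw [dist_comm]
    refine (hk.dist_le_of_inv_near ?_).trans (le_max_right _ _)
    rw [dist_comm]
    exact hp.dist_eq.trans_le (h1 y hy)

theorem exists_contracting_ray (ξ : MorseBoundary x₀) : ∃ (D : ℝ≥0) (α : GeodesicRay X),
    α.1 0 = x₀ ∧ α.endpoint = ξ.point ∧ IsContracting D (range α.1) := by
  obtain ⟨D, α, h⟩ := ξ.exists_mem_stratum
  exact ⟨D, α, h⟩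

/-- There is at most one induced map of Morse boundaries. -/
theorem _root_.IsInducedBoundaryMap.unique {f g : MorseBoundary x₀ → MorseBoundary y₀}
    (hf : IsInducedBoundaryMap h f) (hg : IsInducedBoundaryMap h g) : f = g := by
  ext ξ
  obtain ⟨D, α, -, hα, -⟩ := exists_contracting_ray ξ
  obtain ⟨β, hβ, h1⟩ := hf ξ α hα
  obtain ⟨β', hβ', h2⟩ := hg ξ α hα
  rw [← hβ, ← hβ', endpoint_eq_iff_hausdorffEDist]
  exact hausdorffEDist_trans (hausdorffEDist_symm h1) h2

/-- The maps induced by quasi-inverse maps are inverse to each other. -/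
theorem IsQIPair.leftInverse (hk : IsQIPair L E h k) {f : MorseBoundary x₀ → MorseBoundary y₀}
    {g : MorseBoundary y₀ → MorseBoundary x₀} (hf : IsInducedBoundaryMap h f)
    (hg : IsInducedBoundaryMap k g) : Function.LeftInverse g f := by
  intro ξ
  ext
  obtain ⟨D, α, -, hα, -⟩ := exists_contracting_ray ξ
  obtain ⟨β, hβ, h1⟩ := hf ξ α hα
  obtain ⟨α', hα', h2⟩ := hg (f ξ) β hβ
  rw [← hα, ← hα', endpoint_eq_iff_hausdorffEDist]
  exact hausdorffEDist_symm (hausdorffEDist_trans (hk.hausdorffEDist_image_image _)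
    (hausdorffEDist_trans (hk.symm.hausdorffEDist_image h1) h2))

variable [ProperSpace X] [ProperSpace Y] [CAT0Space Y]

/-- The induced map exists, and it maps the points of a stratum to points of a stratum,
represented by rays that are uniformly close to the images of the original rays. -/
theorem IsQIPair.exists_induced (hk : IsQIPair L E h k) (x₀ : X) (y₀ : Y) :
    ∃ f : MorseBoundary x₀ → MorseBoundary y₀, IsInducedBoundaryMap h f ∧
      ∀ D : ℝ≥0, ∃ (N : ℝ) (D' : ℝ≥0), ∀ (ξ : MorseBoundary x₀) (α : GeodesicRay X),
        α.1 0 = x₀ → α.endpoint = ξ.point → IsContracting D (range α.1) →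
        ∃ β : GeodesicRay Y, β.1 0 = y₀ ∧ β.endpoint = (f ξ).point ∧
          IsContracting D' (range β.1) ∧ ∀ x ∈ range α.1, Metric.infDist (h x) (range β.1) ≤ N := by
  choose N D' hN using hk.exists_ray x₀ y₀
  choose D α hα0 hαe hαc using exists_contracting_ray (x₀ := x₀)
  choose β hβ0 hβc hβ1 hβ2 using fun ξ => hN (D ξ) (α ξ) (hα0 ξ) (hαc ξ)
  set f : MorseBoundary x₀ → MorseBoundary y₀ :=
    fun ξ => ⟨(β ξ).endpoint, D' (D ξ), β ξ, hβ0 ξ, rfl, hβc ξ⟩ with hf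
  have hind : IsInducedBoundaryMap h f := by
    intro ξ α' hα'
    refine ⟨β ξ, rfl, ?_⟩
    have h1 : Metric.hausdorffEDist (range α'.1) (range (α ξ).1) ≠ ⊤ :=
      (endpoint_eq_iff_hausdorffEDist _ _).1 (hα'.trans (hαe ξ).symm)
    exact hausdorffEDist_trans (hk.hausdorffEDist_image h1) (hk.hausdorffEDist_image_of_infDist
      (isClosed_range_ray _) (isClosed_range_ray _) (range_nonempty _) (range_nonempty _)
      (hβ1 ξ) (hβ2 ξ))
  refine ⟨f, hind, fun D₀ => ⟨N D₀, D' D₀, fun ξ α' hα0' hαe' hαc' => ?_⟩⟩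
  obtain ⟨β', hβ0', hβc', hβ1', hβ2'⟩ := hN D₀ α' hα0' hαc'
  refine ⟨β', hβ0', ?_, hβc', hβ2'⟩
  obtain ⟨β'', hβ'', h2⟩ := hind ξ α' hαe'
  rw [← hβ'', endpoint_eq_iff_hausdorffEDist]
  exact hausdorffEDist_trans (hausdorffEDist_symm (hk.hausdorffEDist_image_of_infDist
    (isClosed_range_ray _) (isClosed_range_ray _) (range_nonempty _) (range_nonempty _)
    hβ1' hβ2')) h2

end Induced

section Continuity

variable {X : Type u} {Y : Type v} [MetricSpace X] [MetricSpace Y]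
  {L E : ℝ} {h : X → Y} {k : Y → X} {x₀ : X} {y₀ : Y}

/-- The rays from `x₀`, with the topology of uniform convergence on compact sets. -/
abbrev BasedRay (x₀ : X) : Type u := {α : GeodesicRay X // α.1 0 = x₀}

/-- In a CAT(0) space the rays from `x₀` embed in the visual boundary. -/
theorem isInducing_endpoint [CAT0Space X] (x₀ : X) :
    @IsInducing (BasedRay x₀) (VisualBoundary X) _ (visualTopology x₀)
      fun α => GeodesicRay.endpoint α.1 := by
  let := visualTopology x₀
  have hinj : Function.Injective fun α : BasedRay x₀ => GeodesicRay.endpoint α.1 :=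
    fun α β hαβ => Subtype.ext (ray_eq_of_endpoint_eq (α.2.trans β.2.symm) hαβ)
  refine ⟨TopologicalSpace.ext_iff.2 fun U => ?_⟩
  rw [isOpen_induced_iff]
  constructor
  · intro hU
    refine ⟨(fun α : BasedRay x₀ => GeodesicRay.endpoint α.1) '' U, ?_, preimage_image_eq _ hinj⟩
    rw [isOpen_coinduced, preimage_image_eq _ hinj]
    exact hU
  · rintro ⟨V, hV, rfl⟩
    exact isOpen_coinduced.1 hV

/-- Two rays from `y₀` that pass near the images under `h` of points at distance `T` from `x₀` that
are close to each other, are close to each other for a time proportional to `T`. -/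
theorem IsQIPair.dist_le_of_infDist_le [ProperSpace Y] [CAT0Space Y] (hk : IsQIPair L E h k)
    {β β' : GeodesicRay Y} (hβ : β.1 0 = y₀) (hβ' : β'.1 0 = y₀) {x x' : X} {N S : ℝ}
    (hS : 0 < S) (hx : L * (S + N + dist (h x₀) y₀) + 3 * E ≤ dist x₀ x) (hxx : dist x x' ≤ 1)
    (h1 : Metric.infDist (h x) (range β.1) ≤ N) (h2 : Metric.infDist (h x') (range β'.1) ≤ N)
    {u : ℝ} (hu : 0 ≤ u) (huS : u ≤ S) :
    dist (rayFun β u) (rayFun β' u) ≤ u / S * (2 * (2 * N + L + E)) := by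
  have hL := hk.one_le
  obtain ⟨p, hp⟩ := exists_isNearestPoint (isClosed_range_ray β) (range_nonempty _) (h x)
  obtain ⟨s, rfl⟩ := hp.1
  obtain ⟨p', hp'⟩ := exists_isNearestPoint (isClosed_range_ray β') (range_nonempty _) (h x')
  obtain ⟨s', rfl⟩ := hp'.1
  have d1 := hp.dist_eq.trans_le h1
  have d2 := hp'.dist_eq.trans_le h2
  rw [← rayFun_coe] at d1 d2
  have g := rayFun_isGeodOn β
  have g' := rayFun_isGeodOn β'
  have m : (s : ℝ) ∈ Ici (0 : ℝ) := s.coe_nonneg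
  have m' : (s' : ℝ) ∈ Ici (0 : ℝ) := s'.coe_nonneg
  have hβ0 : rayFun β 0 = y₀ := by rw [rayFun_zero, hβ]
  have hβ0' : rayFun β' 0 = y₀ := by rw [rayFun_zero, hβ']
  have e1 := g.dist_eq self_mem_Ici m m
  have e2 := g'.dist_eq self_mem_Ici m' m'
  rw [hβ0, sub_zero] at e1
  rw [hβ0', sub_zero] at e2
  have e3 : dist (rayFun β s) (rayFun β' s') ≤ 2 * N + L + E := by
    have t1 := dist_triangle4 (rayFun β s) (h x) (h x') (rayFun β' s')
    have t2 := hk.left x x'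
    have t3 := mul_le_mul_of_nonneg_left hxx (by linarith : 0 ≤ L)
    rw [dist_comm (rayFun β s) (h x)] at t1
    linarith
  have e4 : |(s : ℝ) - s'| ≤ 2 * N + L + E := by
    have t1 := dist_triangle y₀ (rayFun β s) (rayFun β' s')
    have t2 := dist_triangle_right y₀ (rayFun β s) (rayFun β' s')
    exact abs_le.2 ⟨by linarith, by linarith⟩
  have e5 : dist (rayFun β s) (rayFun β' s) ≤ 2 * (2 * N + L + E) := by
    have := dist_triangle_right (rayFun β s) (rayFun β' s) (rayFun β' s')
    rw [g' s m s' m'] at this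
    linarith
  have e6 : S ≤ s := by
    have t1 := hk.symm.lower x₀ x
    have t2 := dist_triangle4 (h x₀) y₀ (rayFun β s) (h x)
    rw [dist_comm (rayFun β s) (h x)] at t2
    have t3 : L * dist (h x₀) (h x) ≤ L * (s + N + dist (h x₀) y₀) :=
      mul_le_mul_of_nonneg_left (by linarith) (by linarith)
    have t4 : L * (S + N + dist (h x₀) y₀) ≤ L * (s + N + dist (h x₀) y₀) := by linarith
    linarith [le_of_mul_le_mul_left t4 (by linarith)]
  have hs0 : (0 : ℝ) < s := hS.trans_le e6
  have k1 := dist_geod_le (g.mono Icc_subset_Ici_self) (g'.mono Icc_subset_Ici_self) hu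
    (huS.trans e6) hs0
  rw [hβ0, hβ0', dist_self, mul_zero, zero_add, sub_zero, sub_zero] at k1
  refine k1.trans ?_
  have : 0 ≤ 2 * (2 * N + L + E) := dist_nonneg.trans e5
  gcongr

theorem IsQIPair.continuous_based [ProperSpace Y] [CAT0Space Y] (hk : IsQIPair L E h k)
    {Z : Type*} [TopologicalSpace Z]
    {r : Z → BasedRay x₀} (hr : Continuous r) {G : Z → BasedRay y₀} {N : ℝ}
    (hG : ∀ z, ∀ x ∈ range (r z).1.1, Metric.infDist (h x) (range (G z).1.1) ≤ N) :
    Continuous G := by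
  refine Continuous.subtype_mk (Continuous.subtype_mk ?_ _) _
  rw [continuous_iff_continuousAt]
  intro z
  rw [ContinuousAt, ContinuousMap.tendsto_iff_forall_isCompact_tendstoUniformlyOn]
  intro K hK
  rw [Metric.tendstoUniformlyOn_iff]
  intro ε hε
  obtain ⟨T, hT⟩ := hK.bddAbove
  have hN : 0 ≤ N := Metric.infDist_nonneg.trans (hG z _ (mem_range_self 0))
  set M := 2 * (2 * N + L + E) with hM
  have hL := hk.one_le
  have hE := hk.nonneg
  have hM0 : 0 ≤ M := by linarith
  have hT0 : (0 : ℝ) ≤ T := T.coe_nonneg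
  have hq : 0 ≤ T * M / ε := by positivity
  set S : ℝ := T + T * M / ε + 1 with hS
  have hS0 : 0 < S := by linarith
  have hA0 : 0 ≤ L * (S + N + dist (h x₀) y₀) + 3 * E := by positivity
  set A : ℝ≥0 := ⟨L * (S + N + dist (h x₀) y₀) + 3 * E, hA0⟩ with hA
  have hcont : Continuous fun w => (r w).1.1 A :=
    (continuous_eval_const (F := C(ℝ≥0, X)) A).comp
      (continuous_subtype_val.comp (continuous_subtype_val.comp hr))
  have hev := hcont.continuousAt.eventually (Metric.ball_mem_nhds ((r z).1.1 A) one_pos)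
  filter_upwards [hev] with w hw x hx
  have hd : dist ((r z).1.1 A) ((r w).1.1 A) ≤ 1 := by
    rw [dist_comm]; exact hw.le
  have hxA : dist x₀ ((r z).1.1 A) = A := by
    have := (r z).1.2.dist_eq 0 A
    rwa [(r z).2, NNReal.dist_eq, NNReal.coe_zero, zero_sub, abs_neg, abs_of_nonneg A.coe_nonneg] at this
  have hxT : (x : ℝ) ≤ T := hT hx
  have key := hk.dist_le_of_infDist_le (G z).2 (G w).2 hS0 hxA.ge hd
    (hG z _ (mem_range_self A)) (hG w _ (mem_range_self A)) x.coe_nonneg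
    (by linarith : (x : ℝ) ≤ S)
  rw [rayFun_coe, rayFun_coe] at key
  refine key.trans_lt ?_
  calc (x : ℝ) / S * M ≤ T / S * M := by gcongr
    _ = T * M / S := by ring
    _ < ε := by
      rw [div_lt_iff₀ hS0]
      have : T * M / ε * ε = T * M := by field_simp
      nlinarith

/-- An induced map is continuous: on each stratum this holds because rays from `y₀` that are close
to each other at a large time are very close at small times. -/
theorem IsQIPair.continuous_induced [CAT0Space X] [ProperSpace Y] [CAT0Space Y]
    (hk : IsQIPair L E h k)
    {f : MorseBoundary x₀ → MorseBoundary y₀} (hf : ∀ D : ℝ≥0, ∃ (N : ℝ) (D' : ℝ≥0),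
      ∀ (ξ : MorseBoundary x₀) (α : GeodesicRay X),
        α.1 0 = x₀ → α.endpoint = ξ.point → IsContracting D (range α.1) →
        ∃ β : GeodesicRay Y, β.1 0 = y₀ ∧ β.endpoint = (f ξ).point ∧
          IsContracting D' (range β.1) ∧
          ∀ x ∈ range α.1, Metric.infDist (h x) (range β.1) ≤ N) : Continuous f := by
  rw [morseTopology, continuous_iSup_dom]
  intro D
  rw [continuous_coinduced_dom]
  obtain ⟨N, D', hN⟩ := hf D
  choose α hα0 hαe hαc using fun ξ : morseStratum x₀ D => ξ.2
  choose β hβ0 hβe hβc hβ using fun ξ : morseStratum x₀ D =>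
    hN (morseInclusion x₀ D ξ) (α ξ) (hα0 ξ) (hαe ξ) (hαc ξ)
  let tX := visualTopology x₀
  let tY := visualTopology y₀
  have hr : Continuous fun ξ : morseStratum x₀ D => (⟨α ξ, hα0 ξ⟩ : BasedRay x₀) := by
    rw [(isInducing_endpoint x₀).continuous_iff]
    exact continuous_subtype_val.congr fun ξ => (hαe ξ).symm
  have hG : Continuous fun ξ : morseStratum x₀ D => (⟨β ξ, hβ0 ξ⟩ : BasedRay y₀) :=
    hk.continuous_based hr hβ
  set F : morseStratum x₀ D → morseStratum y₀ D' :=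
    fun ξ => ⟨(β ξ).endpoint, β ξ, hβ0 ξ, rfl, hβc ξ⟩ with hF
  have hFc : Continuous F :=
    Continuous.subtype_mk ((isInducing_endpoint y₀).continuous.comp hG) _
  have hinc : Continuous (morseInclusion y₀ D') := by
    rw [continuous_iff_coinduced_le]
    exact le_iSup (fun D : ℝ≥0 => TopologicalSpace.coinduced (morseInclusion y₀ D)
      (TopologicalSpace.induced Subtype.val (visualTopology y₀))) D'
  have e : f ∘ morseInclusion x₀ D = morseInclusion y₀ D' ∘ F := by
    funext ξ
    exact MorseBoundary.ext (hβe ξ).symm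
  rw [e]
  exact hinc.comp hFc

end Continuity

/-! ### Stability and cross-ratios -/

section CrossRatio

variable {X : Type u} {Y : Type v} [MetricSpace X] [MetricSpace Y]
  {L E : ℝ} {h : X → Y} {k : Y → X} {x₀ : X} {y₀ : Y}

theorem IsQIPair.near_of_hausdorffEDist (hk : IsQIPair L E h k) {α : GeodesicRay X}
    {β : GeodesicRay Y} (hαβ : Metric.hausdorffEDist (h '' range α.1) (range β.1) ≠ ⊤) :
    ∃ K, ∀ t, 0 ≤ t → ∃ s, 0 ≤ s ∧ dist (k (rayFun β t)) (rayFun α s) ≤ K := by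
  obtain ⟨K, -, h2⟩ := hausdorffEDist_ne_top_iff.1 hαβ
  refine ⟨L * K + E + E, fun t _ => ?_⟩
  obtain ⟨_, ⟨_, ⟨s, rfl⟩, rfl⟩, hs⟩ := h2 (rayFun β t) ⟨_, rfl⟩
  refine ⟨s, s.coe_nonneg, ?_⟩
  rw [rayFun_coe]
  have e1 := hk.right (rayFun β t) (h (α.1 s))
  have e2 := dist_triangle (k (rayFun β t)) (k (h (α.1 s))) (α.1 s)
  have e3 := mul_le_mul_of_nonneg_left hs (by linarith [hk.one_le] : 0 ≤ L)
  linarith [hk.left_inv (α.1 s)]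

theorem hausdorffEDist_image_of_induced {f : MorseBoundary x₀ → MorseBoundary y₀}
    (hf : IsInducedBoundaryMap h f) {ξ : MorseBoundary x₀} {α : GeodesicRay X}
    {β : GeodesicRay Y} (hα : α.endpoint = ξ.point) (hβ : β.endpoint = (f ξ).point) :
    Metric.hausdorffEDist (h '' range α.1) (range β.1) ≠ ⊤ := by
  obtain ⟨β', hβ', h1⟩ := hf ξ α hα
  exact hausdorffEDist_trans h1 ((endpoint_eq_iff_hausdorffEDist _ _).1 (hβ'.trans hβ.symm))

theorem exists_line [ProperSpace X] [CAT0Space X] {ξ η : MorseBoundary x₀} (hne : ξ ≠ η) :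
    ∃ γ : GeodesicLine X, γ.Joins ξ.point η.point := by
  obtain ⟨D, α, hα0, hα, hαc⟩ := exists_contracting_ray ξ
  obtain ⟨D', β, hβ0, hβ, -⟩ := exists_contracting_ray η
  rw [← hα, ← hβ]
  refine exists_line_joins (hα0.trans hβ0.symm) hαc fun he => hne (MorseBoundary.ext ?_)
  rw [← hα, ← hβ, he]

theorem NearTriangle.map [ProperSpace Y] (hk : IsQIPair L E h k) {C N : ℝ}
    {γ η ζ : GeodesicLine X} {γ' η' ζ' : GeodesicLine Y} {x : X} (hx : NearTriangle C γ η ζ x)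
    (hγ : ∀ x ∈ range γ.1, Metric.infDist (h x) (range γ'.1) ≤ N)
    (hη : ∀ x ∈ range η.1, Metric.infDist (h x) (range η'.1) ≤ N)
    (hζ : ∀ x ∈ range ζ.1, Metric.infDist (h x) (range ζ'.1) ≤ N) :
    NearTriangle (L * C + E + N) γ' η' ζ' (h x) := by
  have key : ∀ (φ : GeodesicLine X) (φ' : GeodesicLine Y), (∃ s, dist x (φ.1 s) ≤ C) →
      (∀ x ∈ range φ.1, Metric.infDist (h x) (range φ'.1) ≤ N) →
      ∃ s, dist (h x) (φ'.1 s) ≤ L * C + E + N := by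
    rintro φ φ' ⟨s, hs⟩ hφ
    obtain ⟨p, hp⟩ := exists_isNearestPoint (isClosed_range_line φ') (range_nonempty _)
      (h (φ.1 s))
    obtain ⟨s', rfl⟩ := hp.1
    refine ⟨s', ?_⟩
    have e1 := hp.dist_eq.trans_le (hφ _ (mem_range_self s))
    have e2 := hk.left x (φ.1 s)
    have e3 := mul_le_mul_of_nonneg_left hs (by linarith [hk.one_le] : 0 ≤ L)
    linarith [dist_triangle (h x) (h (φ.1 s)) (φ'.1 s')]
  exact ⟨key γ γ' hx.1 hγ, key η η' hx.2.1 hη, key ζ ζ' hx.2.2 hζ⟩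

variable [ProperSpace X] [ProperSpace Y] [CAT0Space Y]

theorem IsQIPair.induced_line_near [CAT0Space X] (hk : IsQIPair L E h k) (x₀ : X) (y₀ : Y)
    (D : ℝ≥0) :
    ∃ (N : ℝ) (D' : ℝ≥0), ∀ f : MorseBoundary x₀ → MorseBoundary y₀, IsInducedBoundaryMap h f →
      ∀ (ξ η : MorseBoundary x₀) (γ : GeodesicLine X) (γ' : GeodesicLine Y),
      IsContracting D (range γ.1) → γ.Joins ξ.point η.point →
      γ'.Joins (f ξ).point (f η).point →
      IsContracting D' (range γ'.1) ∧
        ∀ x ∈ range γ.1, Metric.infDist (h x) (range γ'.1) ≤ N := by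
  obtain ⟨N, D', hN⟩ := hk.line_near D
  refine ⟨N, D', fun f hf ξ η γ γ' hγ hj hj' => hN γ γ' hγ ?_ ?_⟩
  · obtain ⟨K, hK⟩ := hk.near_of_hausdorffEDist (hausdorffEDist_image_of_induced hf hj.2 hj'.2)
    refine ⟨K, fun t ht => ?_⟩
    obtain ⟨s, hs, h1⟩ := hK t ht
    exact ⟨s, hs, by rwa [rayFun_forwardRay _ ht, rayFun_forwardRay _ hs] at h1⟩
  · obtain ⟨K, hK⟩ := hk.near_of_hausdorffEDist (hausdorffEDist_image_of_induced hf hj.1 hj'.1)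
    refine ⟨K, fun t ht => ?_⟩
    obtain ⟨s, hs, h1⟩ := hK t ht
    exact ⟨s, hs, by rwa [rayFun_backwardRay _ ht, rayFun_backwardRay _ hs] at h1⟩

theorem IsQIPair.comp_mem_contractingTuples [CAT0Space X] (hk : IsQIPair L E h k) (x₀ : X)
    (y₀ : Y) (D : ℝ≥0) :
    ∃ D' : ℝ≥0, ∀ f : MorseBoundary x₀ → MorseBoundary y₀, IsInducedBoundaryMap h f →
      Function.Injective f → ∀ (n : ℕ), ∀ a ∈ contractingTuples x₀ n D,
        f ∘ a ∈ contractingTuples y₀ n D' := by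
  obtain ⟨N, D', hN⟩ := hk.induced_line_near x₀ y₀ D
  refine ⟨D', fun f hf hinj n a ha => ⟨hinj.comp ha.1, fun i j hij γ' hγ' => ?_⟩⟩
  obtain ⟨γ, hγ⟩ := exists_line (ha.1.ne hij)
  exact (hN f hf _ _ γ γ' (ha.2 i j hij γ hγ) hγ hγ').1

/-- Induced maps coarsely commute with the projections of boundary points to lines. -/
theorem IsQIPair.dist_boundaryProjection_le [CAT0Space X] (hk : IsQIPair L E h k) (x₀ : X)
    (y₀ : Y) (D : ℝ≥0) :
    ∃ C : ℝ, ∀ f : MorseBoundary x₀ → MorseBoundary y₀, IsInducedBoundaryMap h f →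
      Function.Injective f → ∀ (n : ℕ), ∀ a ∈ contractingTuples x₀ n D, ∀ i j l : Fin n,
      i ≠ j → l ≠ j → ∀ (γ : GeodesicLine X) (γ' : GeodesicLine Y),
      i ≠ l → γ.Joins (a i).point (a l).point → γ'.Joins (f (a i)).point (f (a l)).point →
      ∀ m m', IsBoundaryProjection γ (a j).point m → IsBoundaryProjection γ' (f (a j)).point m' →
      dist (h m) m' ≤ C := by
  obtain ⟨N, D', hN⟩ := hk.induced_line_near x₀ y₀ D
  refine ⟨8 * max (L * (9 * (9 * D + 5)) + E + N) (9 * (9 * D' + 5)), ?_⟩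
  intro f hf hinj n a ha i j l hij hlj γ γ' hil hγ hγ' m m' hm hm'
  have hne : ∀ {i j : Fin n}, i ≠ j → (a i).point ≠ (a j).point := fun hij he =>
    hij (ha.1 (MorseBoundary.ext he))
  have hne' : ∀ {i j : Fin n}, i ≠ j → (f (a i)).point ≠ (f (a j)).point := fun hij he =>
    hij (ha.1 (hinj (MorseBoundary.ext he)))
  obtain ⟨η, hη⟩ := exists_line (ha.1.ne hij)
  obtain ⟨ζ, hζ⟩ := exists_line (ha.1.ne hlj)
  obtain ⟨η', hη'⟩ := exists_line (hinj.ne (ha.1.ne hij))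
  obtain ⟨ζ', hζ'⟩ := exists_line (hinj.ne (ha.1.ne hlj))
  have cγ := ha.2 i l hil γ hγ
  obtain ⟨cγ', nγ⟩ := hN f hf _ _ γ γ' cγ hγ hγ'
  obtain ⟨-, nη⟩ := hN f hf _ _ η η' (ha.2 i j hij η hη) hη hη'
  obtain ⟨-, nζ⟩ := hN f hf _ _ ζ ζ' (ha.2 l j hlj ζ hζ) hζ hζ'
  have t := (nearTriangle_of_isBoundaryProjection cγ hγ hη hζ (hne hij) (hne hlj) hm).map hk
    nγ nη nζ
  have t' := nearTriangle_of_isBoundaryProjection cγ' hγ' hη' hζ' (hne' hij) (hne' hlj) hm'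
  exact (t.mono (le_max_left _ _)).dist_le hγ' hη' hζ' (t'.mono (le_max_right _ _))

theorem IsQIPair.dist_projections_le [CAT0Space X] (hk : IsQIPair L E h k) (x₀ : X)
    (y₀ : Y) (D : ℝ≥0) :
    ∃ C : ℝ, ∀ f : MorseBoundary x₀ → MorseBoundary y₀, IsInducedBoundaryMap h f →
      Function.Injective f → ∀ a ∈ contractingTuples x₀ 4 D,
      ∀ (γ : GeodesicLine X) (γ' : GeodesicLine Y), γ.Joins (a 0).point (a 2).point →
      γ'.Joins (f (a 0)).point (f (a 2)).point → ∀ p q p' q',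
      IsBoundaryProjection γ (a 1).point p → IsBoundaryProjection γ (a 3).point q →
      IsBoundaryProjection γ' (f (a 1)).point p' → IsBoundaryProjection γ' (f (a 3)).point q' →
      dist p' q' ≤ L * dist p q + C := by
  obtain ⟨C, hC⟩ := hk.dist_boundaryProjection_le x₀ y₀ D
  refine ⟨E + 2 * C, fun f hf hinj a ha γ γ' hγ hγ' p q p' q' hp hq hp' hq' => ?_⟩
  have e1 := hC f hf hinj 4 a ha 0 1 2 (by decide) (by decide) γ γ' (by decide) hγ hγ' p p' hp hp'
  have e2 := hC f hf hinj 4 a ha 0 3 2 (by decide) (by decide) γ γ' (by decide) hγ hγ' q q' hq hq'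
  have e3 := hk.left p q
  have e4 := dist_triangle4 p' (h p) (h q) q'
  rw [dist_comm p' (h p)] at e4
  linarith

end CrossRatio

theorem isQIPair_id {X : Type u} [MetricSpace X] : IsQIPair 1 0 (id : X → X) id :=
  ⟨le_rfl, le_rfl, by simp, by simp, by simp, by simp⟩

theorem isInducedBoundaryMap_id {X : Type u} [MetricSpace X] {x₀ : X} : IsInducedBoundaryMap (id : X → X)
    (id : MorseBoundary x₀ → MorseBoundary x₀) :=
  fun ξ α hα => ⟨α, hα, by simp⟩

section Existence

variable {X : Type u} [MetricSpace X] [ProperSpace X] [CAT0Space X] {x₀ : X}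

theorem exists_projections {D : ℝ≥0} {a : Fin 4 → MorseBoundary x₀}
    (ha : a ∈ contractingTuples x₀ 4 D) : ∃ (γ : GeodesicLine X) (p q : X),
      γ.Joins (a 0).point (a 2).point ∧ IsBoundaryProjection γ (a 1).point p ∧
      IsBoundaryProjection γ (a 3).point q := by
  obtain ⟨γ, hγ⟩ := exists_line (ha.1.ne (show (0 : Fin 4) ≠ 2 by decide))
  have key : ∀ j : Fin 4, 0 ≠ j → 2 ≠ j → ∃ m, IsBoundaryProjection γ (a j).point m := by
    intro j h0 h2
    obtain ⟨η, hη⟩ := exists_line (ha.1.ne h0)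
    obtain ⟨ζ, hζ⟩ := exists_line (ha.1.ne h2)
    exact exists_isBoundaryProjection (ha.2 0 2 (by decide) γ hγ) hγ hη hζ
      (fun he => h0 (ha.1 (MorseBoundary.ext he))) fun he => h2 (ha.1 (MorseBoundary.ext he))
  obtain ⟨p, hp⟩ := key 1 (by decide) (by decide)
  obtain ⟨q, hq⟩ := key 3 (by decide) (by decide)
  exact ⟨γ, p, q, hγ, hp, hq⟩

/-- The absolute cross-ratio of a contracting 4-tuple exists. The set whose supremum it is is
bounded, because the identity coarsely commutes with projections to two different lines with the
same endpoints. -/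
theorem exists_hasAbsCrossRatio {D : ℝ≥0} {a : Fin 4 → MorseBoundary x₀}
    (ha : a ∈ contractingTuples x₀ 4 D) :
    ∃ r : ℝ≥0, HasAbsCrossRatio (a 0) (a 1) (a 2) (a 3) r := by
  obtain ⟨C, hC⟩ := isQIPair_id.dist_projections_le x₀ x₀ D
  obtain ⟨γ, p, q, hγ, hp, hq⟩ := exists_projections ha
  have hlub := isLUB_csSup (s := {s : ℝ | ∃ (γ : GeodesicLine X) (p q : X),
    γ.Joins (a 0).point (a 2).point ∧ IsBoundaryProjection γ (a 1).point p ∧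
      IsBoundaryProjection γ (a 3).point q ∧ s = dist p q})
    ⟨_, γ, p, q, hγ, hp, hq, rfl⟩ ⟨1 * dist p q + C, by
      rintro _ ⟨γ', p', q', hγ', hp', hq', rfl⟩
      exact hC id isInducedBoundaryMap_id Function.injective_id a ha γ γ' hγ hγ' p q p' q'
        hp hq hp' hq'⟩
  exact ⟨⟨_, dist_nonneg.trans (hlub.1 ⟨γ, p, q, hγ, hp, hq, rfl⟩)⟩, hlub⟩

end Existence

section Main

variable {X : Type u} {Y : Type v} [MetricSpace X] [MetricSpace Y]
  [ProperSpace X] [ProperSpace Y] [CAT0Space X] [CAT0Space Y] {h : X → Y} {k : Y → X}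

theorem IsQIPair.crossRatioControl {lam : ℝ≥0} {E : ℝ} (hk : IsQIPair lam E h k) (x₀ : X)
    (y₀ : Y) (D : ℝ≥0) :
    ∃ C₀ : ℝ≥0, ∀ f : MorseBoundary x₀ → MorseBoundary y₀, IsInducedBoundaryMap h f →
      Function.Injective f → ∀ C : ℝ≥0, C₀ ≤ C → CrossRatioControl D (fun t => lam * t + C) f := by
  obtain ⟨C₀, hC₀⟩ := hk.dist_projections_le x₀ y₀ D
  obtain ⟨D', hD'⟩ := hk.comp_mem_contractingTuples x₀ y₀ D
  refine ⟨C₀.toNNReal, fun f hf hinj C hC a ha => ?_⟩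
  obtain ⟨r, hr⟩ := exists_hasAbsCrossRatio ha
  obtain ⟨r', hr'⟩ := exists_hasAbsCrossRatio (hD' f hf hinj 4 a ha)
  refine ⟨r, r', hr, hr', ?_⟩
  rw [← NNReal.coe_le_coe]
  push_cast
  refine hr'.2 ?_
  rintro _ ⟨γ', p', q', hγ', hp', hq', rfl⟩
  obtain ⟨γ, p, q, hγ, hp, hq⟩ := exists_projections ha
  have h1 := hC₀ f hf hinj a ha γ γ' hγ hγ' p q p' q' hp hq hp' hq'
  have h2 : dist p q ≤ r := hr.1 ⟨γ, p, q, hγ, hp, hq, rfl⟩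
  have h3 : C₀ ≤ C := Real.toNNReal_le_iff_le_coe.1 hC
  have h4 : (lam : ℝ) * dist p q ≤ lam * r := by gcongr
  linarith

/-- A quasi-isometry has a quasi-inverse with the same multiplicative constant. -/
theorem _root_.IsQuasiIsometry.exists_isQIPair {X : Type u} {Y : Type v} [MetricSpace X]
    [MetricSpace Y] {lam eps : ℝ≥0} {h : X → Y} (hh : IsQuasiIsometry lam eps h) :
    ∃ (E : ℝ) (k : Y → X), IsQIPair lam E h k := by
  obtain ⟨C, hC⟩ := hh.coarsely_onto
  choose k hk using hC
  have hlam : (1 : ℝ) ≤ lam := hh.one_le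
  have lower : ∀ x x', dist x x' ≤ lam * dist (h x) (h x') + lam * eps := by
    intro x x'
    have h1 := hh.lower x x'
    rw [sub_le_iff_le_add, div_le_iff₀ (by linarith)] at h1
    linarith
  have heps : (0 : ℝ) ≤ eps := eps.coe_nonneg
  have hle : (0 : ℝ) ≤ lam * eps := by positivity
  have h1 : (eps : ℝ) ≤ lam * eps := le_mul_of_one_le_left heps hlam
  have hC' : |C| ≤ lam * |C| := le_mul_of_one_le_left (abs_nonneg C) hlam
  have hCabs := le_abs_self C
  have hC0 := abs_nonneg C
  refine ⟨2 * (lam * |C|) + lam * eps, k, hlam, by linarith, fun x x' => ?_, fun y y' => ?_,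
    fun x => ?_, fun y => ?_⟩
  · linarith [hh.upper x x']
  · have e1 := lower (k y) (k y')
    have e2 := dist_triangle4 (h (k y)) y y' (h (k y'))
    rw [dist_comm y' (h (k y'))] at e2
    have e3 : (lam : ℝ) * dist (h (k y)) (h (k y')) ≤ lam * (dist y y' + 2 * |C|) := by
      gcongr
      linarith [hk y, hk y']
    linarith
  · have e1 := lower (k (h x)) x
    have e2 : (lam : ℝ) * dist (h (k (h x))) (h x) ≤ lam * |C| := by
      gcongr
      exact (hk (h x)).trans hCabs
    linarith
  · linarith [hk y]

end Main

end CAT0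

theorem theorem3p5 {X : Type u} {Y : Type v} [MetricSpace X] [MetricSpace Y]
    [ProperSpace X] [ProperSpace Y] [CAT0Space X] [CAT0Space Y]
    (x₀ : X) (y₀ : Y) (lam eps : ℝ≥0) (h : X → Y) (hh : IsQuasiIsometry lam eps h) :
    ∃ f : MorseBoundary x₀ ≃ₜ MorseBoundary y₀,
      (∀ g : MorseBoundary x₀ → MorseBoundary y₀, IsInducedBoundaryMap h g ↔ g = f) ∧
      IsTwoStable f ∧
      IsQuasiMobius f ∧
      ∀ D : ℝ≥0, ∃ C : ℝ≥0,
        CrossRatioControl D (fun t => lam * t + C) f ∧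
        CrossRatioControl D (fun t => lam * t + C) f.symm := by
  obtain ⟨E, k, hk⟩ := hh.exists_isQIPair
  obtain ⟨f, hf, hf'⟩ := hk.exists_induced x₀ y₀
  obtain ⟨g, hg, hg'⟩ := hk.symm.exists_induced y₀ x₀
  have hgf := hk.leftInverse hf hg
  have hfg := hk.symm.leftInverse hg hf
  have control : ∀ D : ℝ≥0, ∃ C : ℝ≥0, CrossRatioControl D (fun t => lam * t + C) f ∧
      CrossRatioControl D (fun t => lam * t + C) g := by
    intro D
    obtain ⟨C₁, h₁⟩ := hk.crossRatioControl x₀ y₀ D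
    obtain ⟨C₂, h₂⟩ := hk.symm.crossRatioControl y₀ x₀ D
    exact ⟨max C₁ C₂, h₁ f hf hgf.injective _ (le_max_left _ _),
      h₂ g hg hfg.injective _ (le_max_right _ _)⟩
  refine ⟨⟨⟨f, g, hgf, hfg⟩, hk.continuous_induced hf', hk.symm.continuous_induced hg'⟩,
    fun g' => ⟨fun hg' => hg'.unique hf, fun e => e ▸ hf⟩, fun D => ?_, fun D => ?_, control⟩
  · obtain ⟨D', hD'⟩ := hk.comp_mem_contractingTuples x₀ y₀ D
    exact ⟨D', fun a ha => hD' f hf hgf.injective 2 a ha⟩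
  · obtain ⟨C, h₁, h₂⟩ := control D
    exact ⟨⟨_, by fun_prop, h₁⟩, ⟨_, by fun_prop, h₂⟩⟩
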